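/- Let $u=\frac{1+\sqrt5}{2}$ and $\omega=\frac{1+\sqrt{-3}}{2}$, and let $\Gamma=\Gamma(5,2,2,3,3,3)$ be the subgroup of $PSL(2,\mathbb C)$ generated by (the classes of) $$x=\begin{pmatrix} u & -u^{-1}\\ u & 0\end{pmatrix},\quad y=\begin{pmatrix} 0 & \omega u^{-1}\\ -\omega^{-1}u & 0\end{pmatrix},\quad z=\begin{pmatrix} 0 & \omega^2 u^{-1}\\ -\omega^{-2}u & 0\end{pmatrix}.$$ $PSL(2,\mathbb C)=\mathrm{Isom}^+(\mathbb H^3)$ acts on the upper half-space model of $\mathbb H^3$; the full isometry group $\mathrm{Isom}(\mathbb H^3)$ is the semidirect product of $PSL(2,\mathbb C)$ with the group of order two generated by the reflection $c$ that induces $\zeta\mapsto\bar\zeta$ on $\partial\mathbb H^3$ and acts on $PSL(2,\mathbb C)$ by complex conjugation of the matrix entries. The full commensurator of $\Gamma$ is the group of all $h\in\mathrm{Isom}(\mathbb H^3)$ such that $h\Gamma h^{-1}\cap\Gamma$ has finite index in both $\Gamma$ and $h\Gamma h^{-1}$. A knot group in $\Gamma$ is a finite-index subgroup $\Gamma_K\le\Gamma$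 that acts freely and properly discontinuously on $\mathbb H^3$ and for which $\mathbb H^3/\Gamma_K$ is homeomorphic to the complement $S^3\setminus K$ of a tame knot $K$ in $S^3$. Proposition 3.2. For every knot group $\Gamma_K$ in $\Gamma$ there is an element $h$ of the full commensurator of $\Gamma$, which can be taken in the group generated by $\Gamma$ and $c$, such that $h\Gamma_K h^{-1}$ is a subgroup of $\Gamma$ that contains (the classes of) $$\begin{pmatrix}1&1\\0&1\end{pmatrix}\quad\text{and}\quad\begin{pmatrix}1&0\\-u^2\omega^2&1\end{pmatrix}.$$ -/

import Mathlib

open scoped MatrixGroups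

noncomputable section

namespace DodecahedralKnots

/-! ### Hyperbolic 3-space and the action of `PSL(2, ℂ)` -/

/-- The upper half space model of hyperbolic 3-space: pairs `(z, t)` with `z` complex, `t > 0`. -/
def H3 : Type := {p : ℂ × ℝ // 0 < p.2}

instance : TopologicalSpace H3 := inferInstanceAs (TopologicalSpace {p : ℂ × ℝ // 0 < p.2})

/-- `|c z + d|² + |c|² t²`, where `(c, d)` is the bottom row of `g` and `p = (z, t)`. -/
def denom (g : SL(2, ℂ)) (p : H3) : ℝ :=
  Complex.normSq (g 1 0 * p.1.1 + g 1 1) + Complex.normSq (g 1 0) * p.1.2 ^ 2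

theorem denom_pos (g : SL(2, ℂ)) (p : H3) : 0 < denom g p := by
  have hdet := g.det_coe
  rw [Matrix.det_fin_two] at hdet
  have ht := p.2
  unfold denom
  by_cases hc : g 1 0 = 0
  · have hd : g 1 1 ≠ 0 := by
      intro hd
      rw [hc, hd] at hdet
      simp at hdet
    simp only [hc, zero_mul, zero_add, map_zero, add_zero]
    exact Complex.normSq_pos.mpr hd
  · have := Complex.normSq_pos.mpr hc
    have h2 := Complex.normSq_nonneg (g 1 0 * p.1.1 + g 1 1)
    positivity

/-- The Poincaré extension of a Möbius transformation to upper half space: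
`(z, t) ↦ (((a z + b) conj (c z + d) + a conj c t²) / D, t / D)` with
`D = |c z + d|² + |c|² t²`. -/
def poincareExt (g : SL(2, ℂ)) (p : H3) : H3 :=
  ⟨(((g 0 0 * p.1.1 + g 0 1) * star (g 1 0 * p.1.1 + g 1 1)
      + g 0 0 * star (g 1 0) * (p.1.2 : ℂ) ^ 2) / (denom g p : ℂ), p.1.2 / denom g p),
    div_pos p.2 (denom_pos g p)⟩

theorem denom_cast (g : SL(2, ℂ)) (p : H3) : (denom g p : ℂ) =
    (g 1 0 * p.1.1 + g 1 1) * (star (g 1 0) * star p.1.1 + star (g 1 1))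
      + g 1 0 * star (g 1 0) * (p.1.2 : ℂ) ^ 2 := by
  unfold denom
  push_cast
  rw [← Complex.mul_conj, ← Complex.mul_conj]
  simp

theorem star_det (h : SL(2, ℂ)) :
    star (h 0 0) * star (h 1 1) - star (h 0 1) * star (h 1 0) = 1 := by
  have hdet := h.det_coe
  rw [Matrix.det_fin_two] at hdet
  simpa using congrArg star hdet

theorem denom_mul (g h : SL(2, ℂ)) (p : H3) :
    denom (g * h) p = denom g (poincareExt h p) * denom h p := by
  have hh : (denom h p : ℂ) ≠ 0 := by exact_mod_cast (denom_pos h p).ne'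
  have hstar : star (denom h p : ℂ) = denom h p := Complex.conj_ofReal _
  have hstart : star (p.1.2 : ℂ) = p.1.2 := Complex.conj_ofReal _
  have hdet := h.det_coe
  rw [Matrix.det_fin_two] at hdet
  have hdet' := star_det h
  have hD := denom_cast h p
  have key : (denom (g * h) p : ℂ) = (denom g (poincareExt h p) * denom h p : ℂ) := by
    rw [denom_cast, denom_cast g]
    simp only [poincareExt, Matrix.SpecialLinearGroup.coe_mul, Matrix.mul_apply, Fin.sum_univ_two,
      star_add, star_mul', star_div₀, star_pow, star_star, hstar, hstart, Complex.ofReal_div]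
    field_simp
    rw [hD]
    linear_combination (g 1 0 * star (g 1 0) * (p.1.2 : ℂ) ^ 2) *
      ((star (h 0 0) * star (h 1 1) - star (h 0 1) * star (h 1 0)) * hdet + hdet')
  exact_mod_cast key

theorem poincareExt_mul (g h : SL(2, ℂ)) (p : H3) :
    poincareExt (g * h) p = poincareExt g (poincareExt h p) := by
  have hh : (denom h p : ℂ) ≠ 0 := by exact_mod_cast (denom_pos h p).ne'
  have hg : (denom g (poincareExt h p) : ℂ) ≠ 0 := by
    exact_mod_cast (denom_pos g (poincareExt h p)).ne'
  have hstar : star (denom h p : ℂ) = denom h p := Complex.conj_ofReal _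
  have hstart : star (p.1.2 : ℂ) = p.1.2 := Complex.conj_ofReal _
  have hdet := h.det_coe
  rw [Matrix.det_fin_two] at hdet
  have hdet' := star_det h
  have hD := denom_cast h p
  have hmul := denom_mul g h p
  apply Subtype.ext
  apply Prod.ext
  · change _ / (denom (g * h) p : ℂ) = _ / (denom g (poincareExt h p) : ℂ)
    rw [hmul, Complex.ofReal_mul, mul_comm (denom g _ : ℂ), ← div_div]
    congr 1
    simp only [poincareExt, Matrix.SpecialLinearGroup.coe_mul, Matrix.mul_apply, Fin.sum_univ_two,
      star_add, star_mul', star_div₀, star_pow, star_star, hstar, hstart, Complex.ofReal_div]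
    field_simp
    rw [hD]
    linear_combination (g 0 0 * star (g 1 0) * (p.1.2 : ℂ) ^ 2) *
      ((star (h 0 0) * star (h 1 1) - star (h 0 1) * star (h 1 0)) * hdet + hdet')
  · change p.1.2 / denom (g * h) p = (p.1.2 / denom h p) / denom g (poincareExt h p)
    rw [hmul, div_div, mul_comm]

instance : MulAction SL(2, ℂ) H3 where
  smul := poincareExt
  one_smul p := by
    change poincareExt 1 p = p
    apply Subtype.ext
    apply Prod.ext <;> simp [poincareExt, denom]
  mul_smul := poincareExt_mul

theorem center_smul (g : SL(2, ℂ)) (hg : g ∈ Subgroup.center SL(2, ℂ)) (p : H3) : g • p = p := by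
  obtain ⟨r, hr, hrg⟩ := Matrix.SpecialLinearGroup.mem_center_iff.mp hg
  have h00 : g 0 0 = r := by rw [← hrg]; simp
  have h01 : g 0 1 = 0 := by rw [← hrg]; simp
  have h10 : g 1 0 = 0 := by rw [← hrg]; simp
  have h11 : g 1 1 = r := by rw [← hrg]; simp
  have hr2 : r ^ 2 = 1 := by simpa using hr
  have hn : Complex.normSq r = 1 := by
    have h := congrArg Complex.normSq hr2
    rw [map_pow, map_one] at h
    exact (pow_eq_one_iff_of_nonneg (Complex.normSq_nonneg r) two_ne_zero).mp h
  have hn' : r * star r = 1 := by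
    have := Complex.mul_conj r
    rw [hn] at this
    simpa using this
  change poincareExt g p = p
  apply Subtype.ext
  apply Prod.ext
  · simp only [poincareExt, denom, h00, h01, h10, h11]
    simp only [zero_mul, zero_add, add_zero, map_zero, hn, star_zero, mul_zero, Complex.ofReal_one,
      div_one]
    linear_combination p.1.1 * hn'
  · simp [poincareExt, denom, h10, h11, hn]

/-- The action of `PSL(2, ℂ)` on hyperbolic 3-space. -/
def toPerm : PSL(2, ℂ) →* Equiv.Perm H3 :=
  QuotientGroup.lift (Subgroup.center SL(2, ℂ)) (MulAction.toPermHom SL(2, ℂ) H3)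
    (fun g hg => Equiv.ext (center_smul g hg))

instance : MulAction PSL(2, ℂ) H3 := MulAction.compHom H3 toPerm

/-! ### The full isometry group -/

/-- A field automorphism of `ℂ` acting on the entries of elements of `SL(2, ℂ)`. -/
def entrywiseSL (σ : ℂ ≃ₐ[ℝ] ℂ) : SL(2, ℂ) ≃* SL(2, ℂ) where
  toFun := Matrix.SpecialLinearGroup.map (σ : ℂ →+* ℂ)
  invFun := Matrix.SpecialLinearGroup.map (σ.symm : ℂ →+* ℂ)
  left_inv g := by ext i j; simp
  right_inv g := by ext i j; simp
  map_mul' := map_mul _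

/-- The action of `Gal(ℂ/ℝ) = {1, complex conjugation}` on the entries of elements of
`PSL(2, ℂ)`. -/
def entrywise : (ℂ ≃ₐ[ℝ] ℂ) →* MulAut PSL(2, ℂ) where
  toFun σ := QuotientGroup.congr _ _ (entrywiseSL σ)
    (Subgroup.characteristic_iff_map_eq.mp inferInstance (entrywiseSL σ))
  map_one' := by
    ext x
    induction x using QuotientGroup.induction_on with
    | H g => rfl
  map_mul' σ τ := by
    ext x
    induction x using QuotientGroup.induction_on with
    | H g => rfl

/-- The full isometry group of hyperbolic 3-space, `PSL(2, ℂ) ⋊ {1, complex conjugation}`: the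
orientation preserving isometries are `PSL(2, ℂ)`, and the reflection `ζ ↦ conj ζ` of the boundary
acts on `PSL(2, ℂ)` by complex conjugation of the matrix entries. -/
abbrev IsomH3 : Type := PSL(2, ℂ) ⋊[entrywise] (ℂ ≃ₐ[ℝ] ℂ)

/-- The inclusion of the orientation preserving isometries. -/
abbrev ofPSL : PSL(2, ℂ) →* IsomH3 := SemidirectProduct.inl

/-- The isometry inducing `ζ ↦ conj ζ` on the boundary. -/
def conjIsom : IsomH3 := SemidirectProduct.inr Complex.conjAe

/-- The full (not necessarily orientation preserving) commensurator of a subgroup of `PSL(2, ℂ)`: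
all isometries `h` of hyperbolic 3-space such that `h Γ h⁻¹ ∩ Γ` has finite index in both `Γ` and
`h Γ h⁻¹`. -/
def fullCommensurator (Γ : Subgroup PSL(2, ℂ)) : Subgroup IsomH3 :=
  Subgroup.Commensurable.commensurator (Γ.map ofPSL)

/-! ### The tetrahedral group `Γ(5,2,2,3,3,3)` -/

/-- The golden ratio, as a complex number. -/
def u : ℂ := (Real.goldenRatio : ℝ)

/-- The primitive sixth root of unity `(1 + √-3) / 2`. -/
def ω : ℂ := (1 + (√3 : ℝ) * Complex.I) / 2

theorem u_ne_zero : u ≠ 0 := by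
  unfold u
  exact_mod_cast Real.goldenRatio_ne_zero

theorem ω_ne_zero : ω ≠ 0 := by
  intro h
  have := congrArg Complex.re h
  simp [ω] at this

/-- A matrix of determinant one, as an element of `SL(2, ℂ)`. -/
def sl (A : Matrix (Fin 2) (Fin 2) ℂ) (hA : A.det = 1) : SL(2, ℂ) := ⟨A, hA⟩

/-- The class in `PSL(2, ℂ)` of a matrix of determinant one. -/
def psl (A : Matrix (Fin 2) (Fin 2) ℂ) (hA : A.det = 1) : PSL(2, ℂ) :=
  QuotientGroup.mk (sl A hA)

def genX : PSL(2, ℂ) :=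
  psl !![u, -u⁻¹; u, 0] (by simp [Matrix.det_fin_two, u_ne_zero])

def genY : PSL(2, ℂ) :=
  psl !![0, ω * u⁻¹; -ω⁻¹ * u, 0] (by
    have := u_ne_zero
    have := ω_ne_zero
    simp only [Matrix.det_fin_two_of]
    field_simp
    ring)

def genZ : PSL(2, ℂ) :=
  psl !![0, ω ^ 2 * u⁻¹; -(ω ^ 2)⁻¹ * u, 0] (by
    have := u_ne_zero
    have := ω_ne_zero
    simp only [Matrix.det_fin_two_of]
    field_simp
    ring)

/-- The group `Γ(5,2,2,3,3,3)`, identified with its image in `PSL(2, ℂ)`. -/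
def Γ522333 : Subgroup PSL(2, ℂ) := Subgroup.closure {genX, genY, genZ}

/-- The meridian `[[1, 1], [0, 1]]`, fixing `∞`. -/
def meridianInfty : PSL(2, ℂ) :=
  psl !![1, 1; 0, 1] (by simp [Matrix.det_fin_two])

/-- The meridian `[[1, 0], [-u² ω², 1]]`, fixing `0`. -/
def meridianZero : PSL(2, ℂ) :=
  psl !![1, 0; -u ^ 2 * ω ^ 2, 1] (by simp [Matrix.det_fin_two])

/-! ### Knot groups -/

/-- The 3-sphere. -/
abbrev S3 : Type := Metric.sphere (0 : EuclideanSpace ℝ (Fin 4)) 1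

/-- `K` is a (tame) knot in the 3-sphere: the core circle of an open tubular neighbourhood
`S¹ × ℝ²`, that is, of an open embedding of `S¹ × ℂ` into the 3-sphere. Every smooth or polygonal
knot has such a neighbourhood, and conversely such a core circle is locally flat, hence tame. -/
def IsTameKnot (K : Set S3) : Prop :=
  ∃ e : Circle × ℂ → S3, Topology.IsOpenEmbedding e ∧ K = e '' {p | p.2 = 0}

/-- A subgroup `ΓK` of `PSL(2, ℂ)` is a knot group if it is discrete (acts properly discontinuously
on hyperbolic 3-space), acts freely, and the quotient manifold, whose fundamental group is `ΓK`, is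
homeomorphic to the complement of a tame knot in the 3-sphere. -/
structure IsKnotGroup (ΓK : Subgroup PSL(2, ℂ)) : Prop where
  discrete : ProperlyDiscontinuousSMul ΓK H3
  free : ∀ g ∈ ΓK, ∀ p : H3, g • p = p → g = 1
  knotComplement : ∃ K : Set S3, IsTameKnot K ∧
    Nonempty (Quotient (MulAction.orbitRel ΓK H3) ≃ₜ {q : S3 // q ∉ K})

end DodecahedralKnots

end

open DodecahedralKnots

namespace DodecahedralKnots

open Topology Filter Set

/-! ### Coverings of the 3-sphere -/

/-! Since `ΓK` has finite index in `Γ522333`, the big group is discrete too, and hyperbolic space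
covers the knot complement with deck group `ΓK`. Lifting a punctured tube around the knot produces a
meridian `μ`. It generates `ΓK` normally (`eq_top_of_meridian_mem`): for a normal `N` containing
`μ`, the covering with group `ΓK ⧸ N` extends over the knot to a covering of the 3-sphere, which has
a section, and connectedness of hyperbolic space then forces the quotient to be trivial.

A knot complement has only one end. A horosphere has compact image in it, so the deep part of the
lifted tube lies in a horoball at some `ΓK`-translate of any given cusp (`exists_horoball_of_lift`).
Applied to the cusps `∞` and `0`, this makes a conjugate of `μ` fix `∞` and gives an element of `ΓK`
carrying `∞` to `0` (`exists_meridian_fixesInfty`).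

Being free, that conjugate is a translation by some `β`, and discreteness puts `β` in `ℤ[ω]`
(`exists_of_trans_mem`). The congruence subgroup modulo `β` contains it, hence all of `ΓK`. The
element carrying `∞` to `0` has a unit of `ℤ[u, ω]` as its lower left entry, so `β` divides a unit
and is a power of `ω`. A rotation about the axis from `0` to `∞` turns `β` into `±1`; conjugating
the translation by `1` with the element exchanging the cusps gives a parabolic element with lower
left entry `-u²ω²ⁱ` (`exists_rot_conj_meridians`).

Only `i` modulo 3 matters. For `i = 0` the product of the two parabolics would be elliptic
(`exists_fixed_point`), against freeness; `i = 1` is the claim, and complex conjugation, which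
preserves `Γ522333` (`map_entrywise_le`), carries `i = 2` to `i = 1`. -/

/-- Stereographic projection identifies the punctured sphere with a real vector space, which is
simply connected, so its inclusion lifts. -/
theorem exists_section_compl_singleton {T : Type*} [TopologicalSpace T] {p : T → S3}
    (cov : IsCoveringMap p) (t₀ : T) (v : S3) (hv : p t₀ ≠ v) :
    ∃ σ : S3 → T, ContinuousOn σ {v}ᶜ ∧ (∀ b ≠ v, p (σ b) = b) ∧ σ (p t₀) = t₀ := by
  have hv1 : ‖(v : EuclideanSpace ℝ (Fin 4))‖ = 1 := by simp
  have hs : (stereographic hv1).source = {v}ᶜ := stereographic_source hv1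
  have ht := stereographic_target hv1
  let φ : C(((ℝ ∙ (v : EuclideanSpace ℝ (Fin 4)))ᗮ : Submodule ℝ _), S3) :=
    ⟨(stereographic hv1).symm, (isOpenEmbedding_stereographic_symm hv1).continuous⟩
  have hφ : ∀ b : S3, b ≠ v → φ (stereographic hv1 b) = b := fun b hb ↦
    (stereographic hv1).left_inv (by rw [hs]; exact hb)
  obtain ⟨F, ⟨hF0, hF⟩, -⟩ := cov.existsUnique_continuousMap_lifts φ
    (stereographic hv1 (p t₀)) t₀ (hφ _ hv).symm
  refine ⟨fun b ↦ F (stereographic hv1 b), ?_, fun b hb ↦ ?_, hF0⟩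
  · exact F.continuous.comp_continuousOn (hs ▸ (stereographic hv1).continuousOn)
  · exact (congrFun hF _).trans (hφ b hb)

/-- Stereographic projection from `v` sends `-v` to the origin, and a three-dimensional space minus
a point is connected. -/
theorem isPreconnected_compl_pair (v : S3) : IsPreconnected ({v}ᶜ ∩ {-v}ᶜ : Set S3) := by
  have hv1 : ‖(v : EuclideanSpace ℝ (Fin 4))‖ = 1 := by simp
  have hs : (stereographic hv1).source = {v}ᶜ := stereographic_source hv1
  have hneg : stereographic hv1 (-v) = 0 := stereographic_apply_neg v
  have hvne : v ≠ -v := ne_neg_of_mem_unit_sphere ℝ v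
  have hc := (isOpenEmbedding_stereographic_symm hv1).continuous
  have hrank : 1 < Module.rank ℝ ((ℝ ∙ (v : EuclideanSpace ℝ (Fin 4)))ᗮ : Submodule ℝ _) := by
    have : Fact (Module.finrank ℝ (EuclideanSpace ℝ (Fin 4)) = 3 + 1) := ⟨by simp⟩
    have h3 := Submodule.finrank_orthogonal_span_singleton (𝕜 := ℝ) (n := 3)
      (v := (v : EuclideanSpace ℝ (Fin 4))) (by intro h; simp [h] at hv1)
    rw [← Module.finrank_eq_rank, h3]
    norm_num
  have h := ((isPathConnected_compl_singleton_of_one_lt_rank hrank 0).isConnected.isPreconnected).image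
    _ hc.continuousOn
  convert h using 1
  ext b
  constructor
  · rintro ⟨hb, hb'⟩
    refine ⟨stereographic hv1 b, ?_, (stereographic hv1).left_inv (by rw [hs]; exact hb)⟩
    intro h0
    apply hb'
    have := (stereographic hv1).injOn (x₁ := b) (x₂ := -v) (by rw [hs]; exact hb)
      (by rw [hs]; exact hvne.symm)
    exact this (by rw [hneg]; exact h0)
  · rintro ⟨w, hw, rfl⟩
    have hmem : (stereographic hv1).symm w ∈ ({v}ᶜ : Set S3) := by
      rw [← hs]; exact (stereographic hv1).map_target (by simp)
    refine ⟨hmem, fun h0 ↦ hw ?_⟩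
    have h1 : stereographic hv1 ((stereographic hv1).symm w) = w :=
      (stereographic hv1).right_inv (by simp)
    rw [mem_singleton_iff.mp h0, hneg] at h1
    exact h1.symm

theorem exists_ne_and_ne_neg (b : S3) : ∃ v : S3, b ≠ v ∧ b ≠ -v := by
  let e (i : Fin 4) : S3 := ⟨EuclideanSpace.single i 1, by simp⟩
  have key : ∀ i j, i ≠ j → (b = e i ∨ b = -e i) → b ≠ e j ∧ b ≠ -e j := by
    intro i j hij hb
    have hbi : (b : EuclideanSpace ℝ (Fin 4)) i ≠ 0 := by
      rcases hb with hb | hb <;> rw [hb] <;> simp [e]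
    constructor <;> rintro rfl <;> apply hbi <;> simp [e, hij]
  by_cases h0 : b ≠ e 0 ∧ b ≠ -e 0
  · exact ⟨_, h0⟩
  · refine ⟨_, key 0 1 (by decide) ?_⟩
    by_contra hcon
    push Not at hcon
    exact h0 hcon

/-- This is the simple connectedness of the sphere in the form needed here: lifts over the
complements of two antipodal points agree at one point of the connected overlap, hence on all of it,
and glue. -/
theorem exists_section_of_isCoveringMap {T : Type*} [TopologicalSpace T] {p : T → S3}
    (cov : IsCoveringMap p) (t₀ : T) : ∃ σ : S3 → T, Continuous σ ∧ ∀ b, p (σ b) = b := by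
  classical
  obtain ⟨v, hv, hv'⟩ := exists_ne_and_ne_neg (p t₀)
  obtain ⟨σ, hσ, hσp, hσ0⟩ := exists_section_compl_singleton cov t₀ v hv
  obtain ⟨τ, hτ, hτp, hτ0⟩ := exists_section_compl_singleton cov t₀ (-v) hv'
  have hvne : v ≠ -v := ne_neg_of_mem_unit_sphere ℝ v
  have heq : ({v}ᶜ ∩ {-v}ᶜ : Set S3).EqOn σ τ :=
    cov.eqOn_of_comp_eqOn (isPreconnected_compl_pair v) (hσ.mono inter_subset_left)
      (hτ.mono inter_subset_right) (fun b hb ↦ (hσp b hb.1).trans (hτp b hb.2).symm)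
      (a := p t₀) ⟨hv, hv'⟩ (hσ0.trans hτ0.symm)
  refine ⟨fun b ↦ if b = v then τ b else σ b, continuous_iff_continuousAt.mpr fun b ↦ ?_,
    fun b ↦ ?_⟩
  · by_cases hb : b = v
    · refine ((hτ.continuousAt (isOpen_compl_singleton.mem_nhds (?_ : b ≠ -v)))).congr ?_
      · rw [hb]; exact hvne
      · filter_upwards [isOpen_compl_singleton.mem_nhds (show b ≠ -v by rw [hb]; exact hvne)]
          with c hc
        split_ifs with h
        · rfl
        · exact (heq ⟨h, hc⟩).symm
    · refine ((hσ.continuousAt (isOpen_compl_singleton.mem_nhds hb))).congr ?_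
      filter_upwards [isOpen_compl_singleton.mem_nhds hb] with c hc
      exact (if_neg hc).symm
  · dsimp only
    split_ifs with h
    · exact hτp b (by rw [h]; exact hvne)
    · exact hσp b h

/-- A locally constant cocycle on the 3-sphere with values in a group is a coboundary. -/
theorem exists_trivialization_of_cocycle {ι G : Type*} [Group G] (W : ι → Set S3)
    (hW : ∀ i, IsOpen (W i)) (hcover : ∀ b, ∃ i, b ∈ W i) (g : ι → ι → S3 → G)
    (hself : ∀ i b, g i i b = 1) (hcomp : ∀ i j k b, g i j b * g j k b = g i k b)
    (hloc : ∀ i j, ∀ b ∈ W i ∩ W j, ∀ᶠ b' in 𝓝 b, g i j b' = g i j b) :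
    ∃ σ : ι → S3 → G, (∀ i j, ∀ b ∈ W i ∩ W j, σ i b = g i j b * σ j b) ∧
      ∀ i, ∀ b ∈ W i, ∀ᶠ b' in 𝓝 b, σ i b' = σ i b := by
  choose idx hidx using hcover
  let : TopologicalSpace G := ⊥
  have : DiscreteTopology G := ⟨rfl⟩
  let Z : FiberBundleCore ι S3 G :=
    { baseSet := W
      isOpen_baseSet := hW
      indexAt := idx
      mem_baseSet_at := hidx
      -- A change from chart `i` to chart `j` multiplies by `g j i`, so the indices are reversed.
      -- Left multiplication makes the fibre a discrete torsor, and the bundle a covering.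
      coordChange := fun i j b v ↦ g j i b * v
      coordChange_self := fun i b _ v ↦ by rw [hself, one_mul]
      continuousOn_coordChange := by
        rintro i j ⟨b, v⟩ ⟨hb, -⟩
        refine ContinuousAt.continuousWithinAt ?_
        have h1 : ∀ᶠ q : S3 × G in 𝓝 (b, v), g j i q.1 = g j i b :=
          (hloc j i b hb.symm).filter_mono
            (show Tendsto Prod.fst (𝓝 (b, v)) (𝓝 b) from continuous_fst.continuousAt)
        have h2 : ContinuousAt (fun q : S3 × G ↦ g j i b * q.2) (b, v) :=
          (continuous_of_discreteTopology (f := fun w : G ↦ g j i b * w)).continuousAt.comp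
            continuous_snd.continuousAt
        refine h2.congr ?_
        filter_upwards [h1] with q hq
        rw [hq]
      coordChange_comp := fun i j k b _ v ↦ by rw [← mul_assoc, hcomp] }
  have cov : IsCoveringMap Z.proj := FiberBundle.isCoveringMap (F := G) (E := Z.Fiber)
  obtain ⟨s, hs, hsp⟩ := exists_section_of_isCoveringMap cov
    (⟨⟨EuclideanSpace.single 0 1, by simp⟩, (1 : G)⟩ : Z.TotalSpace)
  refine ⟨fun i b ↦ (Z.localTriv i (s b)).2, fun i j b hb ↦ ?_, fun i b hb ↦ ?_⟩
  · have hb' : (s b).proj = b := hsp b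
    have key : ∀ v : G, g i (idx (s b).proj) (s b).proj * v =
        g i j b * (g j (idx (s b).proj) (s b).proj * v) := fun v ↦ by
      rw [← mul_assoc, hb', hcomp]
    exact key _
  · have h1 : ContinuousAt (Z.localTriv i) (s b) := by
      refine (Z.localTriv i).continuousAt ?_
      rw [Z.mem_localTriv_source]
      have : (s b).proj = b := hsp b
      rw [this]
      exact hb
    have h2 : ContinuousAt (fun b ↦ (Z.localTriv i (s b)).2) b :=
      continuous_snd.continuousAt.comp (h1.comp hs.continuousAt)
    exact h2.eventually_mem ((isOpen_discrete {(Z.localTriv i (s b)).2}).mem_nhds rfl)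

/-! ### The fundamental group of a knot complement is normally generated by a meridian -/

section Chart

variable {X Γ : Type*} [Group Γ] [MulAction Γ X]

open Classical in
/-- The class modulo `N` of a group element carrying a point of `V` to `p`. -/
noncomputable def chartFun (N : Subgroup Γ) (V : Set X) (p : X) : Γ ⧸ N :=
  if h : ∃ γ : Γ, γ⁻¹ • p ∈ V then QuotientGroup.mk h.choose else QuotientGroup.mk 1

/-- The translates of `V` by elements not in `N` are disjoint from `V`. -/
def IsSmallMod (N : Subgroup Γ) (V : Set X) : Prop :=
  ∀ γ : Γ, ∀ x ∈ V, γ • x ∈ V → γ ∈ N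

variable {N : Subgroup Γ} {V : Set X}

theorem chartFun_smul_of_mem (hV : IsSmallMod N V) {x : X} (hx : x ∈ V) (γ : Γ) :
    chartFun N V (γ • x) = QuotientGroup.mk γ := by
  have h : ∃ δ : Γ, δ⁻¹ • (γ • x) ∈ V := ⟨γ, by simpa using hx⟩
  unfold chartFun
  rw [dif_pos h, QuotientGroup.eq]
  exact hV _ x hx (by simpa [mul_smul] using h.choose_spec)

/-- The equivariance that lets two charts differ by a function on the quotient space. -/
theorem chartFun_smul [N.Normal] (hV : IsSmallMod N V) {p : X} (hp : ∃ γ : Γ, ∃ x ∈ V, γ • x = p)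
    (δ : Γ) : chartFun N V (δ • p) = QuotientGroup.mk δ * chartFun N V p := by
  obtain ⟨γ, x, hx, rfl⟩ := hp
  rw [← mul_smul, chartFun_smul_of_mem hV hx, chartFun_smul_of_mem hV hx]
  rfl

theorem eventually_chartFun_eq [TopologicalSpace X] [ContinuousConstSMul Γ X]
    (hV : IsSmallMod N V) (hVo : IsOpen V) {p : X} (hp : ∃ γ : Γ, ∃ x ∈ V, γ • x = p) :
    ∀ᶠ q in 𝓝 p, chartFun N V q = chartFun N V p := by
  obtain ⟨γ, x, hx, rfl⟩ := hp
  have h : ∀ᶠ q in 𝓝 (γ • x), γ⁻¹ • q ∈ V :=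
    (continuous_const_smul γ⁻¹).continuousAt.eventually_mem (hVo.mem_nhds (by simpa using hx))
  filter_upwards [h] with q hq
  rw [chartFun_smul_of_mem hV hx]
  simpa using chartFun_smul_of_mem hV hq γ

end Chart

theorem Circle_exp_isOpenMap : IsOpenMap Circle.exp :=
  isLocalHomeomorph_circleExp.isOpenMap

section Normal

variable {X Γ : Type*} [Group Γ] [MulAction Γ X]
  {π : X → S3} {e : Circle × ℂ → S3} {L : ℝ × ℂ → X}

/-- Over an arc of the knot, the lift of a punctured tubular neighbourhood is small modulo any
normal subgroup containing the meridian. -/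
theorem isSmallMod_lift_arc
    (hfree : ∀ γ : Γ, ∀ x : X, γ • x = x → γ = 1)
    (he : IsOpenEmbedding e)
    (hfib : ∀ x y, π x = π y ↔ ∃ γ : Γ, γ • x = y)
    (hLπ : ∀ s w, π (L (s, w)) = e (Circle.exp s, Complex.exp w)) {μ : Γ}
    (hμ : ∀ s w, L (s, w + 2 * Real.pi * Complex.I) = μ • L (s, w)) {N : Subgroup Γ} (hN : μ ∈ N)
    (s₀ : ℝ) : IsSmallMod N (L '' (Ioo (s₀ - Real.pi) (s₀ + Real.pi) ×ˢ univ)) := by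
  have hzpow : ∀ (n : ℤ) s w, L (s, w + n * (2 * Real.pi * Complex.I)) = μ ^ n • L (s, w) := by
    intro n s
    induction n with
    | zero => simp
    | succ n ih =>
      intro w
      have : w + ((n : ℤ) + 1 : ℤ) * (2 * Real.pi * Complex.I) =
          (w + (n : ℤ) * (2 * Real.pi * Complex.I)) + 2 * Real.pi * Complex.I := by
        push_cast; ring
      rw [this, hμ, ih, zpow_add, zpow_one, ← mul_smul]
      group
    | pred n ih =>
      intro w
      rw [show μ ^ (-(n : ℤ) - 1) = μ⁻¹ * μ ^ (-(n : ℤ)) by group, mul_smul, ← ih,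
        eq_inv_smul_iff, ← hμ]
      congr 2
      push_cast
      ring
  rintro γ _ ⟨⟨s, w⟩, ⟨hs, -⟩, rfl⟩ ⟨⟨s', w'⟩, ⟨hs', -⟩, h⟩
  have h1 : π (L (s, w)) = π (L (s', w')) := (hfib _ _).mpr ⟨γ, h.symm⟩
  rw [hLπ, hLπ] at h1
  obtain ⟨h2, h3⟩ := Prod.mk.inj (he.injective h1)
  -- An open interval of length `2π` embeds in the circle, so two points of the lift over the same
  -- point of the tube differ by a power of the meridian only.
  have h4 : s = s' := Circle.exp_injOn_Ioc (a := s₀ - Real.pi) (b := s₀ + Real.pi)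
    (by linarith) (Ioo_subset_Ioc_self hs) (Ioo_subset_Ioc_self hs') h2
  obtain ⟨n, hn⟩ := Complex.exp_eq_exp_iff_exists_int.mp h3.symm
  subst h4
  rw [hn, hzpow] at h
  have h5 : γ⁻¹ * μ ^ n = 1 := hfree _ (L (s, w)) (by rw [mul_smul, h, inv_smul_smul])
  rw [inv_mul_eq_one.mp h5]
  exact N.zpow_mem hN n

variable [TopologicalSpace X]

/-- A lift of an open map through a locally injective map is open. -/
theorem isOpen_image_lift (hπ : Continuous π)
    (hfib : ∀ x y, π x = π y ↔ ∃ γ : Γ, γ • x = y)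
    (hdisj : ∀ x : X, ∃ U ∈ 𝓝 x, ∀ γ : Γ, ((γ • ·) '' U ∩ U).Nonempty → γ = 1)
    (he : IsOpenEmbedding e) (hL : Continuous L)
    (hLπ : ∀ s w, π (L (s, w)) = e (Circle.exp s, Complex.exp w))
    {O : Set (ℝ × ℂ)} (hO : IsOpen O) : IsOpen (L '' O) := by
  have hE : IsOpenMap (fun x : ℝ × ℂ ↦ e (Circle.exp x.1, Complex.exp x.2)) :=
    he.isOpenMap.comp (Circle_exp_isOpenMap.prodMap Complex.isOpenMap_exp)
  rw [isOpen_iff_mem_nhds]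
  rintro _ ⟨x₀, hx₀, rfl⟩
  obtain ⟨U, hU, hUd⟩ := hdisj (L x₀)
  have hO' : IsOpen (O ∩ L ⁻¹' interior U) := hO.inter (isOpen_interior.preimage hL)
  have hE' := hE _ hO'
  have hmem : L x₀ ∈ interior U := mem_interior_iff_mem_nhds.mpr hU
  have hn : interior U ∩ π ⁻¹' ((fun x : ℝ × ℂ ↦ e (Circle.exp x.1, Complex.exp x.2)) ''
      (O ∩ L ⁻¹' interior U)) ∈ 𝓝 (L x₀) :=
    (isOpen_interior.inter (hE'.preimage hπ)).mem_nhds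
      ⟨hmem, x₀, ⟨hx₀, hmem⟩, (hLπ x₀.1 x₀.2).symm⟩
  filter_upwards [hn]
  rintro p ⟨hpU, x, ⟨hxO, hxU⟩, hx⟩
  refine ⟨x, hxO, ?_⟩
  obtain ⟨γ, hγ⟩ := (hfib (L x) p).mp ((hLπ x.1 x.2).trans hx)
  have h1 : γ = 1 := hUd γ ⟨p, ⟨L x, interior_subset hxU, hγ⟩, interior_subset hpU⟩
  rw [h1, one_smul] at hγ
  exact hγ

variable [PreconnectedSpace X] [ContinuousConstSMul Γ X]

/-- If `X → S³ \ K` is a regular covering with group `Γ` and connected total space, then `Γ` is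
normally generated by the deck transformation belonging to a meridian of `K`. -/
theorem eq_top_of_meridian_mem (hπ : Continuous π) (hopen : IsOpenMap π)
    (hfib : ∀ x y, π x = π y ↔ ∃ γ : Γ, γ • x = y)
    (hdisj : ∀ x : X, ∃ U ∈ 𝓝 x, ∀ γ : Γ, ((γ • ·) '' U ∩ U).Nonempty → γ = 1)
    (he : IsOpenEmbedding e) (hrange : range π = (e '' {p | p.2 = 0})ᶜ) (hL : Continuous L)
    (hLπ : ∀ s w, π (L (s, w)) = e (Circle.exp s, Complex.exp w)) {μ : Γ}
    (hμ : ∀ s w, L (s, w + 2 * Real.pi * Complex.I) = μ • L (s, w)) (N : Subgroup Γ) [N.Normal]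
    (hN : μ ∈ N) : N = ⊤ := by
  classical
  have hfree : ∀ γ : Γ, ∀ x : X, γ • x = x → γ = 1 := fun γ x hx ↦ by
    obtain ⟨U, hU, hUd⟩ := hdisj x
    exact hUd γ ⟨x, ⟨x, mem_of_mem_nhds hU, hx⟩, mem_of_mem_nhds hU⟩
  choose U hU hUd using hdisj
  -- the charts
  let V : X ⊕ ℝ → Set X := Sum.elim (fun x ↦ interior (U x))
    (fun s ↦ L '' (Ioo (s - Real.pi) (s + Real.pi) ×ˢ univ))
  let W : X ⊕ ℝ → Set S3 := Sum.elim (fun x ↦ π '' interior (U x))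
    (fun s ↦ e '' ((Circle.exp '' Ioo (s - Real.pi) (s + Real.pi)) ×ˢ univ))
  have hVo : ∀ i, IsOpen (V i) := by
    rintro (x | s)
    · exact isOpen_interior
    · exact isOpen_image_lift hπ hfib (fun x ↦ ⟨U x, hU x, hUd x⟩) he hL hLπ
        (isOpen_Ioo.prod isOpen_univ)
  have hVs : ∀ i, IsSmallMod N (V i) := by
    rintro (x | s)
    · intro γ y hy hy'
      rw [hUd x γ ⟨_, ⟨y, interior_subset hy, rfl⟩, interior_subset hy'⟩]
      exact N.one_mem
    · exact isSmallMod_lift_arc hfree he hfib hLπ hμ hN s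
  have hWo : ∀ i, IsOpen (W i) := by
    rintro (x | s)
    · exact hopen _ isOpen_interior
    · exact he.isOpenMap _ ((Circle_exp_isOpenMap _ isOpen_Ioo).prod isOpen_univ)
  have hWV : ∀ i p, π p ∈ W i → ∃ γ : Γ, ∃ x ∈ V i, γ • x = p := by
    rintro (x | s) p
    · rintro ⟨y, hy, hyp⟩
      obtain ⟨γ, hγ⟩ := (hfib y p).mp hyp
      exact ⟨γ, y, hy, hγ⟩
    · rintro ⟨⟨θ, z⟩, ⟨⟨s', hs', rfl⟩, -⟩, hyp⟩
      have hz : z ≠ 0 := by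
        rintro rfl
        have : π p ∈ (e '' {p | p.2 = 0})ᶜ := hrange ▸ mem_range_self p
        exact this ⟨_, rfl, hyp⟩
      obtain ⟨γ, hγ⟩ := (hfib (L (s', Complex.log z)) p).mp
        (by rw [hLπ, Complex.exp_log hz]; exact hyp)
      exact ⟨γ, _, ⟨_, ⟨hs', mem_univ _⟩, rfl⟩, hγ⟩
  have hcover : ∀ b, ∃ i, b ∈ W i := by
    intro b
    by_cases hb : b ∈ range π
    · obtain ⟨x, rfl⟩ := hb
      exact ⟨.inl x, x, mem_interior_iff_mem_nhds.mpr (hU x), rfl⟩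
    · rw [hrange, notMem_compl_iff] at hb
      obtain ⟨⟨θ, z⟩, -, rfl⟩ := hb
      refine ⟨.inr (Complex.arg θ), _, ⟨⟨Complex.arg θ, ?_, Circle.exp_arg θ⟩, mem_univ _⟩, rfl⟩
      constructor <;> linarith [Real.pi_pos]
  -- a point of `X` associated with every point of the sphere
  have hρ : ∀ b : S3, ∃ p : X, (b ∈ range π → π p = b) ∧
      ∀ θ, b = e (θ, 0) → ∃ s, p = L (s, 0) ∧ Circle.exp s = θ := by
    intro b
    by_cases hb : b ∈ range π
    · obtain ⟨p, hp⟩ := hb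
      refine ⟨p, fun _ ↦ hp, fun θ hθ ↦ ?_⟩
      have : π p ∈ (e '' {p | p.2 = 0})ᶜ := hrange ▸ mem_range_self p
      exact absurd ⟨_, rfl, (hp.trans hθ).symm⟩ this
    · have hb' := hb
      rw [hrange, notMem_compl_iff] at hb'
      obtain ⟨⟨θ, z⟩, hz, rfl⟩ := hb'
      refine ⟨L (Complex.arg θ, 0), fun h ↦ absurd h hb, fun θ' hθ' ↦ ?_⟩
      refine ⟨_, rfl, ?_⟩
      rw [Circle.exp_arg]
      exact (Prod.mk.inj (he.injective hθ')).1
  choose ρ hρ1 hρ2 using hρ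
  let f : X ⊕ ℝ → X → Γ ⧸ N := fun i ↦ chartFun N (V i)
  -- Off the knot, where both charts are defined, this ratio does not depend on the chosen point of
  -- the fibre, by equivariance. On the knot, `ρ` supplies a nearby point of the lifted tube
  -- instead, which extends the cocycle over the knot.
  let g : X ⊕ ℝ → X ⊕ ℝ → S3 → Γ ⧸ N := fun i j b ↦ (f i (ρ b))⁻¹ * f j (ρ b)
  have hfsmul : ∀ i p (γ : Γ), π p ∈ W i → f i (γ • p) = QuotientGroup.mk γ * f i p :=
    fun i p γ hp ↦ chartFun_smul (hVs i) (hWV i p hp) γ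
  have hfloc : ∀ i p, π p ∈ W i → ∀ᶠ q in 𝓝 p, f i q = f i p :=
    fun i p hp ↦ eventually_chartFun_eq (hVs i) (hVo i) (hWV i p hp)
  have hgπ : ∀ i j p q, π p = π q → π p ∈ W i → π p ∈ W j →
      (f i q)⁻¹ * f j q = (f i p)⁻¹ * f j p := by
    intro i j p q hpq hi hj
    obtain ⟨γ, rfl⟩ := (hfib p q).mp hpq
    rw [hfsmul i p γ hi, hfsmul j p γ hj]
    group
  have hgloc : ∀ i j, ∀ b ∈ W i ∩ W j, ∀ᶠ b' in 𝓝 b, g i j b' = g i j b := by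
    rintro i j b ⟨hbi, hbj⟩
    by_cases hb : b ∈ range π
    · obtain ⟨p, rfl⟩ := hb
      have h1 : ∀ᶠ q in 𝓝 p, g i j (π q) = g i j (π p) := by
        have hi' := hπ.continuousAt.eventually_mem ((hWo i).mem_nhds hbi)
        have hj' := hπ.continuousAt.eventually_mem ((hWo j).mem_nhds hbj)
        filter_upwards [hfloc i p hbi, hfloc j p hbj, hi', hj'] with q h1 h2 h3 h4
        have h5 := hgπ i j q (ρ (π q)) (hρ1 _ (mem_range_self q)).symm h3 h4
        have h6 := hgπ i j p (ρ (π p)) (hρ1 _ (mem_range_self p)).symm hbi hbj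
        change (f i (ρ (π q)))⁻¹ * f j (ρ (π q)) = (f i (ρ (π p)))⁻¹ * f j (ρ (π p))
        rw [h5, h6, h1, h2]
      exact (hopen.nhds_le p) h1
    · have hb' := hb
      rw [hrange, notMem_compl_iff] at hb'
      obtain ⟨⟨θ, z⟩, hz, rfl⟩ := hb'
      obtain rfl : z = 0 := hz
      obtain ⟨s, hρs, rfl⟩ := hρ2 _ θ rfl
      -- both charts belong to arcs
      have harc : ∀ k, e (Circle.exp s, 0) ∈ W k → ∃ t : ℝ, k = .inr t := by
        rintro (x | t) hk
        · obtain ⟨y, -, hy⟩ := hk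
          exact absurd ⟨y, hy⟩ hb
        · exact ⟨t, rfl⟩
      have hex : ∀ k, e (Circle.exp s, 0) ∈ W k → ∀ᶠ s' in 𝓝 s, ∀ z, e (Circle.exp s', z) ∈ W k := by
        intro k hk
        obtain ⟨t, rfl⟩ := harc k hk
        obtain ⟨⟨θ, z⟩, ⟨hθ, -⟩, h⟩ := hk
        have hθ' : θ = Circle.exp s := (Prod.mk.inj (he.injective h)).1
        have := Circle.exp.continuous.continuousAt.eventually_mem
          ((Circle_exp_isOpenMap _ isOpen_Ioo).mem_nhds (hθ' ▸ hθ))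
        filter_upwards [this] with s' hs' z
        exact ⟨_, ⟨hs', mem_univ _⟩, rfl⟩
      obtain ⟨δ, hδ, hball⟩ := Metric.eventually_nhds_iff_ball.mp ((hex i hbi).and (hex j hbj))
      have hpre : IsPreconnected (Metric.ball s δ ×ˢ (univ : Set ℂ)) :=
        (convex_ball s δ).isPreconnected.prod isPreconnected_univ
      -- The set of all `(s', w)` with `s'` close to `s` is connected, so the locally constant
      -- charts are constant on its lift. Hence the transition function has the same value on a
      -- whole neighbourhood of the knot point.
      have hconst : ∀ k, (∀ s' ∈ Metric.ball s δ, ∀ z, e (Circle.exp s', z) ∈ W k) →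
          ∀ s' ∈ Metric.ball s δ, ∀ w, f k (L (s', w)) = f k (L (s, 0)) := by
        intro k hk s' hs' w
        have hlc : ∀ x ∈ Metric.ball s δ ×ˢ (univ : Set ℂ),
            ∀ᶠ y in 𝓝[Metric.ball s δ ×ˢ (univ : Set ℂ)] x, f k (L x) = f k (L y) := by
          rintro ⟨s'', w''⟩ ⟨hs'', -⟩
          refine Filter.Eventually.filter_mono nhdsWithin_le_nhds ?_
          have := hL.continuousAt.eventually (hfloc k (L (s'', w''))
            (by rw [hLπ]; exact hk s'' hs'' _))
          filter_upwards [this] with y hy using hy.symm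
        exact hpre.induction₂ (fun x y ↦ f k (L x) = f k (L y)) hlc
          (fun x y z _ _ _ ↦ Eq.trans) (fun x y _ _ ↦ Eq.symm) ⟨hs', mem_univ _⟩
          ⟨Metric.mem_ball_self hδ, mem_univ _⟩
      have hci := hconst i fun s' hs' ↦ (hball s' hs').1
      have hcj := hconst j fun s' hs' ↦ (hball s' hs').2
      have hn : e '' ((Circle.exp '' Metric.ball s δ) ×ˢ univ) ∈ 𝓝 (e (Circle.exp s, 0)) :=
        (he.isOpenMap _ ((Circle_exp_isOpenMap _ Metric.isOpen_ball).prod isOpen_univ)).mem_nhds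
          ⟨_, ⟨⟨s, Metric.mem_ball_self hδ, rfl⟩, mem_univ _⟩, rfl⟩
      filter_upwards [hn]
      rintro _ ⟨⟨_, z⟩, ⟨⟨s', hs', rfl⟩, -⟩, rfl⟩
      have hw : ∃ w, π (L (s', w)) = π (ρ (e (Circle.exp s', z))) := by
        by_cases hz : z = 0
        · subst hz
          obtain ⟨s'', hs1, hs2⟩ := hρ2 (e (Circle.exp s', 0)) _ rfl
          exact ⟨0, by rw [hs1, hLπ, hLπ, hs2]⟩
        · refine ⟨Complex.log z, ?_⟩
          rw [hρ1 _, hLπ, Complex.exp_log hz]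
          rw [hrange]
          rintro ⟨⟨θ', z'⟩, hz', h⟩
          exact hz ((Prod.mk.inj (he.injective h)).2 ▸ hz')
      obtain ⟨w, hw⟩ := hw
      change (f i (ρ _))⁻¹ * f j (ρ _) = (f i (ρ _))⁻¹ * f j (ρ _)
      rw [hgπ i j _ _ hw (by rw [hLπ]; exact (hball s' hs').1 _)
        (by rw [hLπ]; exact (hball s' hs').2 _), hρs, hci s' hs' w, hcj s' hs' w]
  obtain ⟨σ, hσ, hσloc⟩ := exists_trivialization_of_cocycle W hWo hcover g
    (fun i b ↦ inv_mul_cancel _) (fun i j k b ↦ by simp only [g]; group) hgloc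
  choose idx hidx using hcover
  -- Correcting each chart by the coboundary makes the result independent of the chart. It stays
  -- equivariant and locally constant, so connectedness gives `γ F(x) = F(x)` modulo `N`.
  let F : X → Γ ⧸ N := fun p ↦ f (idx (π p)) p * σ (idx (π p)) (π p)
  have hF : ∀ i p, π p ∈ W i → F p = f i p * σ i (π p) := by
    intro i p hp
    have h1 := hσ i (idx (π p)) (π p) ⟨hp, hidx _⟩
    have h2 := hgπ i (idx (π p)) p (ρ (π p)) (hρ1 _ (mem_range_self p)).symm hp (hidx _)
    change f (idx (π p)) p * σ (idx (π p)) (π p) = _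
    rw [h1]
    change _ = f i p * ((f i (ρ (π p)))⁻¹ * f _ (ρ (π p)) * _)
    rw [h2]
    group
  have hFloc : IsLocallyConstant F := by
    rw [IsLocallyConstant.iff_eventually_eq]
    intro p
    set i := idx (π p)
    have hi : π p ∈ W i := hidx _
    filter_upwards [hfloc i p hi, hπ.continuousAt.eventually (hσloc i _ hi),
      hπ.continuousAt.eventually_mem ((hWo i).mem_nhds hi)] with q h1 h2 h3
    rw [hF i q h3, hF i p hi, h1, h2]
  rw [eq_top_iff]
  intro γ _
  have x : X := L (0, 0)
  have h1 : F (γ • x) = F x := hFloc.apply_eq_of_preconnectedSpace _ _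
  have h2 : π (γ • x) = π x := ((hfib x (γ • x)).mpr ⟨γ, rfl⟩).symm
  rw [hF _ x (hidx _), hF (idx (π x)) (γ • x) (by rw [h2]; exact hidx _), h2,
    hfsmul _ x γ (hidx _)] at h1
  have h3 : (QuotientGroup.mk γ : Γ ⧸ N) = 1 := by
    simpa [mul_assoc] using h1
  exact (QuotientGroup.eq_one_iff γ).mp h3

end Normal

/-! ### Topology of the action on hyperbolic space -/

instance : T2Space H3 := inferInstanceAs (T2Space {p : ℂ × ℝ // 0 < p.2})

instance : LocallyCompactSpace H3 :=
  (isOpen_lt continuous_const continuous_snd : IsOpen {p : ℂ × ℝ | 0 < p.2}).locallyCompactSpace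

instance : PreconnectedSpace H3 := by
  have h : Convex ℝ {p : ℂ × ℝ | 0 < p.2} :=
    (convex_Ioi (0 : ℝ)).linear_preimage (LinearMap.snd ℝ ℂ ℝ)
  exact isPreconnected_iff_preconnectedSpace.mp h.isPreconnected

theorem continuous_H3_val : Continuous (fun p : H3 ↦ p.1) := continuous_subtype_val

theorem continuous_denom (A : SL(2, ℂ)) : Continuous (denom A) := by
  have h := continuous_H3_val
  have h1 : Continuous (fun p : H3 ↦ p.1.1) := h.fst
  have h2 : Continuous (fun p : H3 ↦ p.1.2) := h.snd
  have h3 := Complex.continuous_normSq.comp ((h1.const_mul (A 1 0)).add_const (A 1 1))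
  exact h3.add ((h2.pow 2).const_mul _)

theorem continuous_poincareExt (A : SL(2, ℂ)) : Continuous (poincareExt A) := by
  have h := continuous_H3_val
  have h1 : Continuous (fun p : H3 ↦ p.1.1) := h.fst
  have h2 : Continuous (fun p : H3 ↦ p.1.2) := h.snd
  have h3 := continuous_denom A
  refine Continuous.subtype_mk (Continuous.prodMk ?_ ?_) _
  · refine Continuous.div ?_ (Complex.continuous_ofReal.comp h3) fun p ↦ ?_
    · exact (((h1.const_mul _).add_const _).mul ((h1.const_mul _).add_const _).star).add
        (((Complex.continuous_ofReal.comp h2).pow 2).const_mul _)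
    · exact_mod_cast (denom_pos A p).ne'
  · exact h2.div h3 fun p ↦ (denom_pos A p).ne'

instance : ContinuousConstSMul PSL(2, ℂ) H3 where
  continuous_const_smul g := by
    induction g using QuotientGroup.induction_on with
    | H A => exact continuous_poincareExt A

instance (G : Subgroup PSL(2, ℂ)) : ContinuousConstSMul G H3 where
  continuous_const_smul g := continuous_const_smul (g : PSL(2, ℂ))

/-- A knot group is the deck transformation group of a covering of a knot complement by hyperbolic
space, it contains a meridian, and it is normally generated by this meridian. -/
theorem IsKnotGroup.exists_covering {ΓK : Subgroup PSL(2, ℂ)} (hK : IsKnotGroup ΓK) :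
    ∃ (π : H3 → S3) (e : Circle × ℂ → S3) (L : ℝ × ℂ → H3) (μ : ΓK),
      Continuous π ∧ IsOpenMap π ∧ (∀ x y, π x = π y ↔ ∃ γ : ΓK, γ • x = y) ∧
      IsOpenEmbedding e ∧ range π = (e '' {p | p.2 = 0})ᶜ ∧ Continuous L ∧
      (∀ s w, π (L (s, w)) = e (Circle.exp s, Complex.exp w)) ∧
      (∀ s w, L (s, w + 2 * Real.pi * Complex.I) = μ • L (s, w)) ∧
      ∀ N : Subgroup ΓK, N.Normal → μ ∈ N → N = ⊤ := by
  have := hK.discrete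
  have hcancel : IsCancelSMul ΓK H3 := ⟨fun g h p hp ↦ by
    have h1 : h⁻¹ * g = 1 := Subtype.ext (hK.free _ (h⁻¹ * g).2 p (by
      change (h⁻¹ * g) • p = p
      rw [mul_smul, hp, inv_smul_smul]))
    exact (inv_mul_eq_one.mp h1).symm⟩
  obtain ⟨K, ⟨e, he, rfl⟩, ⟨φ⟩⟩ := hK.knotComplement
  have hq := (isQuotientCoveringMap_quotientMk_of_properlyDiscontinuousSMul
    (E := H3) (G := ΓK)).homeomorph_comp φ
  have hcov := hq.isCoveringMap
  set q : H3 → {q : S3 // q ∉ e '' {p | p.2 = 0}} := φ ∘ Quotient.mk _ with hqdef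
  have hcl : IsOpen {q : S3 | q ∉ e '' {p | p.2 = 0}} := by
    have : IsCompact (e '' {p | p.2 = 0}) := by
      have h : {p : Circle × ℂ | p.2 = 0} = univ ×ˢ {0} := by ext; simp
      rw [h]
      exact (isCompact_univ.prod isCompact_singleton).image he.continuous
    exact this.isClosed.isOpen_compl
  have hfib : ∀ x y, (q x : S3) = q y ↔ ∃ γ : ΓK, γ • x = y := fun x y ↦ by
    rw [Subtype.coe_inj, eq_comm, hq.apply_eq_iff_mem_orbit]
    rfl
  have hopen : IsOpenMap (fun x ↦ (q x : S3)) :=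
    hcl.isOpenEmbedding_subtypeVal.isOpenMap.comp hq.isOpenQuotientMap.isOpenMap
  have hcont : Continuous (fun x ↦ (q x : S3)) :=
    continuous_subtype_val.comp hq.continuous
  have hrange : range (fun x ↦ (q x : S3)) = (e '' {p | p.2 = 0})ᶜ := by
    ext b
    constructor
    · rintro ⟨x, rfl⟩
      exact (q x).2
    · intro hb
      obtain ⟨x, hx⟩ := hq.surjective ⟨b, hb⟩
      exact ⟨x, by simp only [hx]⟩
  have hE : ∀ x : ℝ × ℂ, e (Circle.exp x.1, Complex.exp x.2) ∉ e '' {p | p.2 = 0} := by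
    rintro x ⟨⟨θ, z⟩, hz, h⟩
    have h' := (Prod.mk.inj (he.injective h)).2
    exact Complex.exp_ne_zero x.2 (h'.symm.trans hz)
  let E : C(ℝ × ℂ, {q : S3 // q ∉ e '' {p | p.2 = 0}}) :=
    ⟨fun x ↦ ⟨e (Circle.exp x.1, Complex.exp x.2), hE x⟩,
      (he.continuous.comp ((Circle.exp.continuous.comp continuous_fst).prodMk
        (Complex.continuous_exp.comp continuous_snd))).subtype_mk _⟩
  obtain ⟨p₀, hp₀⟩ := hq.surjective (E (0, 0))
  obtain ⟨L, ⟨hL0, hL⟩, -⟩ := hcov.existsUnique_continuousMap_lifts E (0, 0) p₀ hp₀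
  have hLπ : ∀ s w, (q (L (s, w)) : S3) = e (Circle.exp s, Complex.exp w) := fun s w ↦
    congrArg Subtype.val (congrFun hL (s, w))
  obtain ⟨μ, hμ0⟩ := (hfib (L (0, 0)) (L (0, 0 + 2 * Real.pi * Complex.I))).mp
    (by rw [hLπ, hLπ, Complex.exp_periodic])
  -- Both sides lift the same map of the simply connected strip and agree at one point, so a single
  -- deck transformation serves everywhere.
  have hμ : (fun x : ℝ × ℂ ↦ L (x.1, x.2 + 2 * Real.pi * Complex.I)) = fun x ↦ μ • L x := by
    refine hcov.eq_of_comp_eq (by fun_prop) (L.continuous.const_smul μ) ?_ (0, 0) hμ0.symm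
    funext x
    apply Subtype.ext
    change (q (L _) : S3) = q (μ • L x)
    rw [← (hfib (L x) (μ • L x)).mpr ⟨μ, rfl⟩, hLπ, Complex.exp_periodic]
    exact (hLπ x.1 x.2).symm
  have hμ' : ∀ s w, L (s, w + 2 * Real.pi * Complex.I) = μ • L (s, w) :=
    fun s w ↦ congrFun hμ (s, w)
  exact ⟨fun x ↦ q x, e, L, μ, hcont, hopen, hfib, he, hrange, L.continuous, hLπ, hμ',
    fun N _ hN ↦ eq_top_of_meridian_mem hcont hopen hfib hq.disjoint he hrange L.continuous hLπ
      hμ' N hN⟩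

/-! ### The ring generated by `u` and `ω` -/

theorem u_sq : u ^ 2 = u + 1 := by
  unfold u
  exact_mod_cast Real.goldenRatio_sq

theorem ω_sq : ω ^ 2 = ω - 1 := by
  have h : ((√3 : ℝ) : ℂ) ^ 2 = 3 := by
    rw [← Complex.ofReal_pow, Real.sq_sqrt (by norm_num)]; norm_num
  unfold ω
  linear_combination (1 / 4) * Complex.I ^ 2 * h + (3 / 4) * Complex.I_sq

theorem ω_pow_three : ω ^ 3 = -1 := by
  linear_combination (ω + 1) * ω_sq

theorem ω_pow_six : ω ^ 6 = 1 := by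
  linear_combination (ω ^ 3 - 1) * ω_pow_three

theorem u_inv : u⁻¹ = u - 1 :=
  inv_eq_of_mul_eq_one_right (by linear_combination u_sq)

theorem ω_inv : ω⁻¹ = 1 - ω :=
  inv_eq_of_mul_eq_one_right (by linear_combination -ω_sq)

/-- The ring `ℤ[u, ω]`. -/
def intRing : Subring ℂ where
  carrier := {x | ∃ m n p q : ℤ, x = m + n * u + (p + q * u) * ω}
  zero_mem' := ⟨0, 0, 0, 0, by simp⟩
  one_mem' := ⟨1, 0, 0, 0, by simp⟩
  add_mem' := by
    rintro _ _ ⟨m, n, p, q, rfl⟩ ⟨m', n', p', q', rfl⟩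
    exact ⟨m + m', n + n', p + p', q + q', by push_cast; ring⟩
  neg_mem' := by
    rintro _ ⟨m, n, p, q, rfl⟩
    exact ⟨-m, -n, -p, -q, by push_cast; ring⟩
  mul_mem' := by
    rintro _ _ ⟨m, n, p, q, rfl⟩ ⟨m', n', p', q', rfl⟩
    refine ⟨m * m' + n * n' - (p * p' + q * q'),
      m * n' + n * m' + n * n' - (p * q' + q * p' + q * q'),
      m * p' + n * q' + p * m' + q * n' + p * p' + q * q',
      m * q' + n * p' + n * q' + p * n' + q * m' + q * n' + p * q' + q * p' + q * q', ?_⟩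
    push_cast
    linear_combination (n * n' + (n * q' + q * n') * ω + q * q' * ω ^ 2) * u_sq +
      (p * p' + (p * q' + q * p') * u + q * q' * (u + 1)) * ω_sq

theorem u_mem : u ∈ intRing := ⟨0, 1, 0, 0, by simp⟩

theorem ω_mem : ω ∈ intRing := ⟨0, 0, 1, 0, by simp⟩

theorem u_inv_mem : u⁻¹ ∈ intRing := u_inv ▸ intRing.sub_mem u_mem intRing.one_mem

theorem ω_inv_mem : ω⁻¹ ∈ intRing := ω_inv ▸ intRing.sub_mem intRing.one_mem ω_mem

theorem ω_re : ω.re = 1 / 2 := by simp [ω]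

theorem ω_im : ω.im = √3 / 2 := by simp [ω]

theorem coeffs_eq_zero_of_golden {m n : ℤ} (h : (m : ℝ) + n * Real.goldenRatio = 0) :
    m = 0 ∧ n = 0 := by
  have hn : n = 0 := by
    by_contra hn
    apply (Real.goldenRatio_irrational.intCast_mul hn).ne_int (-m)
    push_cast
    linarith
  subst hn
  simpa using h

theorem coeffs_re_im (m n p q : ℤ) :
    ((m + n * u + (p + q * u) * ω : ℂ)).re =
      (m + n * Real.goldenRatio) + (p + q * Real.goldenRatio) / 2 ∧
    ((m + n * u + (p + q * u) * ω : ℂ)).im = (p + q * Real.goldenRatio) * (√3 / 2) := by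
  constructor <;> simp [u, ω_re, ω_im]
  ring

/-- Imaginary parts isolate the coefficient of `ω`; irrationality of the golden ratio then separates
the rest. -/
theorem coeffs_eq_zero {m n p q : ℤ} (h : (m + n * u + (p + q * u) * ω : ℂ) = 0) :
    m = 0 ∧ n = 0 ∧ p = 0 ∧ q = 0 := by
  obtain ⟨h1, h2⟩ := coeffs_re_im m n p q
  rw [h] at h1 h2
  simp only [Complex.zero_re, Complex.zero_im] at h1 h2
  have h3 : (p : ℝ) + q * Real.goldenRatio = 0 := by
    have : (√3 / 2 : ℝ) ≠ 0 := by positivity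
    simpa [this] using h2.symm
  rw [h3] at h1
  obtain ⟨h4, h5⟩ := coeffs_eq_zero_of_golden h3
  obtain ⟨h6, h7⟩ := coeffs_eq_zero_of_golden (m := m) (n := n) (by linarith)
  exact ⟨h6, h7, h4, h5⟩

/-- An integral quadratic form with value one determines a power of `ω`. -/
theorem exists_eq_ω_pow {m p : ℤ} (h : m ^ 2 + m * p + p ^ 2 = 1) :
    ∃ k : ℕ, (m + p * ω : ℂ) = ω ^ k := by
  have h1 : m ^ 2 ≤ 1 := by nlinarith [sq_nonneg (m + 2 * p)]
  have h2 : p ^ 2 ≤ 1 := by nlinarith [sq_nonneg (p + 2 * m)]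
  obtain ⟨hm1, hm2⟩ := abs_le.mp ((sq_le_one_iff_abs_le_one m).mp h1)
  obtain ⟨hp1, hp2⟩ := abs_le.mp ((sq_le_one_iff_abs_le_one p).mp h2)
  interval_cases m <;> interval_cases p <;> norm_num at h
  · exact ⟨3, by rw [ω_pow_three]; simp⟩
  · exact ⟨2, by rw [ω_sq]; push_cast; ring⟩
  · exact ⟨4, by push_cast; linear_combination (-ω) * ω_pow_three⟩
  · exact ⟨1, by simp⟩
  · exact ⟨5, by push_cast; linear_combination (-ω ^ 2) * ω_pow_three + ω_sq⟩
  · exact ⟨0, by simp⟩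

/-- The squared modulus is `A + Bφ` with integers `A`, `B`, so `A = 1` and `B = 0`. Here `A` is a
sum of two nonnegative values of the form `a² + ab + b²`, and `B = 0` prevents the part multiplied
by `u` from carrying the value 1. -/
theorem eq_ω_pow_of_normSq_eq_one {x : ℂ} (hx : x ∈ intRing) (h : Complex.normSq x = 1) :
    ∃ k : ℕ, x = ω ^ k := by
  obtain ⟨m, n, p, q, rfl⟩ := hx
  obtain ⟨h1, h2⟩ := coeffs_re_im m n p q
  rw [Complex.normSq_apply, h1, h2] at h
  have h3 : √3 ^ 2 = (3 : ℝ) := Real.sq_sqrt (by norm_num)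
  have h4 := Real.goldenRatio_sq
  have key : ((m ^ 2 + m * p + p ^ 2 + (n ^ 2 + n * q + q ^ 2) - 1 : ℤ) : ℝ) +
      ((2 * m * n + n ^ 2 + (m * q + n * p + n * q) + 2 * p * q + q ^ 2 : ℤ) : ℝ) *
        Real.goldenRatio = 0 := by
    push_cast
    set φ := Real.goldenRatio
    linear_combination h - ((p + q * φ) ^ 2 / 4) * h3 - (n ^ 2 + n * q + q ^ 2) * h4
  obtain ⟨h5, h6⟩ := coeffs_eq_zero_of_golden key
  have h7 : 0 ≤ m ^ 2 + m * p + p ^ 2 := by nlinarith [sq_nonneg (2 * m + p), sq_nonneg p]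
  have h8 : 0 ≤ n ^ 2 + n * q + q ^ 2 := by nlinarith [sq_nonneg (2 * n + q), sq_nonneg q]
  have zero : ∀ a b : ℤ, a ^ 2 + a * b + b ^ 2 = 0 → a = 0 ∧ b = 0 := fun a b hab ↦ by
    constructor <;> apply pow_eq_zero_iff two_ne_zero |>.mp <;>
      nlinarith [sq_nonneg (2 * a + b), sq_nonneg (2 * b + a), sq_nonneg a, sq_nonneg b]
  have h9 : n ^ 2 + n * q + q ^ 2 = 0 := by
    by_contra hne
    have h10 : m ^ 2 + m * p + p ^ 2 = 0 := by omega
    obtain ⟨rfl, rfl⟩ := zero _ _ h10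
    apply hne
    linarith
  obtain ⟨rfl, rfl⟩ := zero _ _ h9
  obtain ⟨k, hk⟩ := exists_eq_ω_pow (m := m) (p := p) (by linarith)
  exact ⟨k, by rw [← hk]; simp⟩

/-- Multiplying by the complex conjugate `m + p - pω` expresses `N δ`, with `N` the norm of `m +
pω`, in the basis. Thus `N` divides both `m` and `p`, and `N² ∣ N` leaves only `N = 1`. -/
theorem eq_ω_pow_of_mul_eq_one {m p : ℤ} {δ : ℂ} (hδ : δ ∈ intRing)
    (h : (m + p * ω) * δ = 1) : ∃ k : ℕ, (m + p * ω : ℂ) = ω ^ k := by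
  obtain ⟨a, b, c, d, rfl⟩ := hδ
  have key : (((m ^ 2 + m * p + p ^ 2) * a - (m + p) : ℤ) + ((m ^ 2 + m * p + p ^ 2) * b : ℤ) * u +
      (((m ^ 2 + m * p + p ^ 2) * c + p : ℤ) + ((m ^ 2 + m * p + p ^ 2) * d : ℤ) * u) * ω : ℂ) = 0 := by
    push_cast
    linear_combination (m + p - p * ω) * h +
      (p ^ 2 * (a + b * u + (c + d * u) * ω)) * ω_sq
  obtain ⟨h1, -, h2, -⟩ := coeffs_eq_zero key
  refine exists_eq_ω_pow ?_
  set N := m ^ 2 + m * p + p ^ 2 with hN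
  have hp : p = N * (-c) := by linarith
  have hm : m = N * (a + c) := by linarith
  have hN2 : N = N * (N * ((a + c) ^ 2 + (a + c) * (-c) + c ^ 2)) := by
    conv_lhs => rw [hN, hp, hm]
    ring
  have hN0 : N ≠ 0 := by
    intro h0
    rw [h0] at hp hm
    simp only [zero_mul] at hp hm
    rw [hp, hm] at h
    simp at h
  have h3 : N * ((a + c) ^ 2 + (a + c) * (-c) + c ^ 2) = 1 :=
    mul_left_cancel₀ hN0 (by rw [← hN2, mul_one])
  have hNn : 0 ≤ N := by rw [hN]; nlinarith [sq_nonneg (2 * m + p), sq_nonneg p]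
  exact Int.eq_one_of_mul_eq_one_right hNn h3

theorem ω_pow_eq (k : ℕ) : ∃ j : ℕ, ω ^ k = (ω ^ 2) ^ j ∨ ω ^ k = -(ω ^ 2) ^ j := by
  rcases Nat.even_or_odd' k with ⟨j, rfl | rfl⟩
  · exact ⟨j, .inl (pow_mul _ _ _)⟩
  · refine ⟨j + 2, .inr ?_⟩
    rw [pow_succ, pow_mul, pow_add]
    linear_combination (ω ^ 2) ^ j * ω * ω_pow_three

theorem normSq_ω : Complex.normSq ω = 1 := by
  have h3 : √3 * √3 = (3 : ℝ) := Real.mul_self_sqrt (by norm_num)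
  rw [Complex.normSq_apply, ω_re, ω_im]
  linear_combination h3 / 4

/-! ### Matrices representing elements of `Γ(5,2,2,3,3,3)` -/

/-- The projection from `SL(2, ℂ)` to `PSL(2, ℂ)`. -/
noncomputable def toPSL : SL(2, ℂ) →* PSL(2, ℂ) := QuotientGroup.mk' _

theorem toPSL_surjective : Function.Surjective toPSL := QuotientGroup.mk'_surjective _

theorem sl_mul_apply (A B : SL(2, ℂ)) (i j : Fin 2) :
    (A * B) i j = A i 0 * B 0 j + A i 1 * B 1 j := by
  rw [Matrix.SpecialLinearGroup.coe_mul, Matrix.mul_apply, Fin.sum_univ_two]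

theorem sl_det (A : SL(2, ℂ)) : A 0 0 * A 1 1 - A 0 1 * A 1 0 = 1 := by
  rw [← Matrix.det_fin_two]
  exact A.det_coe

theorem sl_inv (A : SL(2, ℂ)) : A⁻¹ 0 0 = A 1 1 ∧ A⁻¹ 0 1 = -A 0 1 ∧ A⁻¹ 1 0 = -A 1 0 ∧
    A⁻¹ 1 1 = A 0 0 := by
  rw [Matrix.SpecialLinearGroup.SL2_inv_expl]
  simp

theorem sl_ext {A B : SL(2, ℂ)} (h00 : A 0 0 = B 0 0) (h01 : A 0 1 = B 0 1)
    (h10 : A 1 0 = B 1 0) (h11 : A 1 1 = B 1 1) : A = B := by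
  ext i j
  fin_cases i <;> fin_cases j <;> assumption

theorem toPSL_eq_iff {A B : SL(2, ℂ)} :
    toPSL A = toPSL B ↔ ∃ ε : ℂ, ε ^ 2 = 1 ∧ ∀ i j, B i j = ε * A i j := by
  change (QuotientGroup.mk A : PSL(2, ℂ)) = QuotientGroup.mk B ↔ _
  rw [QuotientGroup.eq, Matrix.SpecialLinearGroup.mem_center_iff]
  constructor
  · rintro ⟨r, hr, h⟩
    refine ⟨r, by simpa using hr, ?_⟩
    have hB : B = A * (A⁻¹ * B) := by group
    intro i j
    rw [hB, sl_mul_apply, ← h]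
    fin_cases j <;> simp [mul_comm]
  · rintro ⟨ε, hε, h⟩
    refine ⟨ε, by simpa using hε, ?_⟩
    obtain ⟨h1, h2, h3, h4⟩ := sl_inv A
    have hdet := sl_det A
    ext i j
    rw [sl_mul_apply, h, h]
    fin_cases i <;> fin_cases j <;> simp [h1, h2, h3, h4]
    · linear_combination -ε * hdet
    · ring
    · ring
    · linear_combination -ε * hdet

theorem finite_preimage_toPSL {S : Set PSL(2, ℂ)} (hS : S.Finite) : (toPSL ⁻¹' S).Finite := by
  refine hS.preimage' fun g _ ↦ ?_
  obtain ⟨A, rfl⟩ := toPSL_surjective g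
  refine Set.Finite.subset (s := {A, -A}) (by simp) ?_
  intro B hB
  obtain ⟨ε, hε, h⟩ := toPSL_eq_iff.mp (show toPSL A = toPSL B from hB.symm)
  rcases sq_eq_sq_iff_eq_or_eq_neg.mp (hε.trans (one_pow 2).symm) with rfl | rfl
  · left
    ext i j
    simp [h]
  · right
    apply sl_ext <;> simp [h]

/-- The generators and their inverses are integral because `u` and `ω` are units; the sign ambiguity
of a representative is harmless. -/
theorem mem_intRing_of_mem {A : SL(2, ℂ)} (hA : toPSL A ∈ Γ522333) (i j : Fin 2) :
    A i j ∈ intRing := by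
  suffices h : ∀ g ∈ Γ522333, ∃ B : SL(2, ℂ), toPSL B = g ∧ ∀ i j, B i j ∈ intRing by
    obtain ⟨B, hB, hBR⟩ := h _ hA
    obtain ⟨ε, hε, h⟩ := toPSL_eq_iff.mp hB
    rw [h]
    rcases sq_eq_sq_iff_eq_or_eq_neg.mp (hε.trans (one_pow 2).symm) with rfl | rfl
    · simpa using hBR i j
    · simpa using hBR i j
  intro g hg
  induction hg using Subgroup.closure_induction with
  | mem g hg =>
    have hw2 := intRing.pow_mem ω_mem 2
    have hwi2 : (ω ^ 2)⁻¹ ∈ intRing := by rw [← inv_pow]; exact intRing.pow_mem ω_inv_mem 2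
    rcases hg with rfl | rfl | rfl
    · refine ⟨sl !![u, -u⁻¹; u, 0] _, rfl, fun i j ↦ ?_⟩
      fin_cases i <;> fin_cases j <;> simp [sl, -inv_pow, u_mem, u_inv_mem, intRing.zero_mem]
    · refine ⟨sl !![0, ω * u⁻¹; -ω⁻¹ * u, 0] _, rfl, fun i j ↦ ?_⟩
      fin_cases i <;> fin_cases j <;>
        simp [sl, intRing.mul_mem ω_mem u_inv_mem, intRing.mul_mem ω_inv_mem u_mem,
          intRing.zero_mem]
    · refine ⟨sl !![0, ω ^ 2 * u⁻¹; -(ω ^ 2)⁻¹ * u, 0] _, rfl, fun i j ↦ ?_⟩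
      fin_cases i <;> fin_cases j <;>
        simp [sl, -inv_pow, intRing.mul_mem hw2 u_inv_mem, intRing.mul_mem hwi2 u_mem,
          intRing.zero_mem]
  | one =>
    refine ⟨1, rfl, fun i j ↦ ?_⟩
    fin_cases i <;> fin_cases j <;> simp [intRing.zero_mem, intRing.one_mem]
  | mul g h _ _ hg hh =>
    obtain ⟨A, rfl, hA⟩ := hg
    obtain ⟨B, rfl, hB⟩ := hh
    refine ⟨A * B, map_mul _ _ _, fun i j ↦ ?_⟩
    rw [sl_mul_apply]
    exact intRing.add_mem (intRing.mul_mem (hA _ _) (hB _ _)) (intRing.mul_mem (hA _ _) (hB _ _))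
  | inv g _ hg =>
    obtain ⟨A, rfl, hA⟩ := hg
    refine ⟨A⁻¹, map_inv _ _, fun i j ↦ ?_⟩
    obtain ⟨h1, h2, h3, h4⟩ := sl_inv A
    fin_cases i <;> fin_cases j <;> simp [h1, h2, h3, h4, hA]

/-- The parabolic matrix inducing the translation by `β`. -/
def translation (β : ℂ) : SL(2, ℂ) := sl !![1, β; 0, 1] (by simp [Matrix.det_fin_two])

/-- The matrix inducing the rotation of order three around the geodesic from `0` to `∞`. -/
noncomputable def rotation : SL(2, ℂ) := sl !![ω⁻¹, 0; 0, ω] (by simp [Matrix.det_fin_two, ω_ne_zero])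

/-- The matrix representing the generator `y`, an involution exchanging `0` and `∞`. -/
noncomputable def inversion : SL(2, ℂ) := sl !![0, ω * u⁻¹; -ω⁻¹ * u, 0] (by
    have := u_ne_zero
    have := ω_ne_zero
    simp only [Matrix.det_fin_two_of]
    field_simp
    ring)

@[simp] theorem trans_apply (β : ℂ) : translation β 0 0 = 1 ∧ translation β 0 1 = β ∧ translation β 1 0 = 0 ∧
    translation β 1 1 = 1 := by simp [translation, sl]

@[simp] theorem rot_apply : rotation 0 0 = ω⁻¹ ∧ rotation 0 1 = 0 ∧ rotation 1 0 = 0 ∧ rotation 1 1 = ω := by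
  simp [rotation, sl]

@[simp] theorem flip_apply : inversion 0 0 = 0 ∧ inversion 0 1 = ω * u⁻¹ ∧ inversion 1 0 = -ω⁻¹ * u ∧
    inversion 1 1 = 0 := by simp [inversion, sl]

theorem toPSL_flip_mem : toPSL inversion ∈ Γ522333 :=
  Subgroup.subset_closure (by right; left; rfl)

/-- The rotation is `y z⁻¹`. -/
theorem toPSL_rot_mem : toPSL rotation ∈ Γ522333 := by
  have hz : genZ ∈ Γ522333 := Subgroup.subset_closure (by right; right; rfl)
  have h : toPSL rotation * genZ = toPSL inversion := by
    change toPSL rotation * toPSL (sl !![0, ω ^ 2 * u⁻¹; -(ω ^ 2)⁻¹ * u, 0] _) = _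
    rw [← map_mul]
    congr 1
    have := ω_ne_zero
    apply sl_ext <;> rw [sl_mul_apply] <;> simp [sl, rotation, inversion] <;> field_simp
  rw [← eq_mul_inv_iff_mul_eq] at h
  rw [h]
  exact Γ522333.mul_mem toPSL_flip_mem (Γ522333.inv_mem hz)

theorem toPSL_trans_one_mem : toPSL (translation 1) ∈ Γ522333 := by
  have hx : genX ∈ Γ522333 := Subgroup.subset_closure (by left; rfl)
  have h : toPSL (translation 1) * toPSL rotation = genX * toPSL inversion := by
    change _ = toPSL (sl !![u, -u⁻¹; u, 0] _) * _
    rw [← map_mul, ← map_mul]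
    congr 1
    have := ω_ne_zero
    have := u_ne_zero
    apply sl_ext <;> rw [sl_mul_apply, sl_mul_apply] <;> simp [sl, rotation, inversion, translation] <;> field_simp
  rw [← eq_mul_inv_iff_mul_eq] at h
  rw [h]
  exact Γ522333.mul_mem (Γ522333.mul_mem hx toPSL_flip_mem) (Γ522333.inv_mem toPSL_rot_mem)

theorem trans_add (β γ : ℂ) : translation (β + γ) = translation β * translation γ := by
  apply sl_ext <;> rw [sl_mul_apply] <;> simp [add_comm]

theorem trans_neg (β : ℂ) : translation (-β) = (translation β)⁻¹ := by
  rw [eq_inv_iff_mul_eq_one, ← trans_add]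
  apply sl_ext <;> simp

theorem trans_nsmul (n : ℕ) (β : ℂ) : translation (n * β) = translation β ^ n := by
  induction n with
  | zero => apply sl_ext <;> simp
  | succ n ih => rw [pow_succ, ← ih, ← trans_add]; congr 1; push_cast; ring

theorem trans_zsmul (n : ℤ) (β : ℂ) : translation (n * β) = translation β ^ n := by
  cases n with
  | ofNat n => simpa using trans_nsmul n β
  | negSucc n =>
    rw [zpow_negSucc, ← trans_nsmul, ← trans_neg]
    congr 1
    push_cast
    ring

theorem rot_mul_trans (β : ℂ) : rotation * translation β = translation ((ω ^ 2)⁻¹ * β) * rotation := by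
  have := ω_ne_zero
  apply sl_ext <;> rw [sl_mul_apply, sl_mul_apply] <;> simp [-inv_pow]
  field_simp

/-- The rotation multiplies translation lengths by `ω⁻² = -ω`. -/
theorem toPSL_trans_ω_mem : toPSL (translation ω) ∈ Γ522333 := by
  have h : translation ω = (rotation * translation 1 * rotation⁻¹)⁻¹ := by
    rw [rot_mul_trans, mul_inv_cancel_right, ← trans_neg]
    congr 1
    have := ω_ne_zero
    rw [mul_one, eq_neg_iff_add_eq_zero]
    field_simp
    linear_combination ω_pow_three
  rw [h, map_inv, map_mul, map_mul, map_inv]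
  exact Γ522333.inv_mem (Γ522333.mul_mem (Γ522333.mul_mem toPSL_rot_mem toPSL_trans_one_mem)
    (Γ522333.inv_mem toPSL_rot_mem))

theorem toPSL_trans_mem (m p : ℤ) : toPSL (translation (m + p * ω)) ∈ Γ522333 := by
  rw [trans_add, map_mul, trans_zsmul, map_zpow]
  refine Γ522333.mul_mem ?_ (Γ522333.zpow_mem toPSL_trans_ω_mem p)
  have := trans_zsmul m 1
  rw [mul_one] at this
  rw [this, map_zpow]
  exact Γ522333.zpow_mem toPSL_trans_one_mem m

/-! ### Discreteness -/

theorem isCompact_box {a b c : ℝ} (hb : 0 < b) :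
    IsCompact {p : H3 | ‖p.1.1‖ ≤ a ∧ b ≤ p.1.2 ∧ p.1.2 ≤ c} := by
  refine Subtype.isCompact_iff.mpr ?_
  convert (isCompact_closedBall (0 : ℂ) a).prod (isCompact_Icc (a := b) (b := c)) using 1
  ext ⟨z, t⟩
  constructor
  · rintro ⟨p, ⟨h1, h2, h3⟩, h⟩
    rw [← h]
    exact ⟨by simpa using h1, h2, h3⟩
  · rintro ⟨h1, h2, h3⟩
    exact ⟨⟨(z, t), lt_of_lt_of_le hb h2⟩, ⟨by simpa using h1, h2, h3⟩, rfl⟩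

/-- The base point `(0, 1)` of hyperbolic space. -/
def basePoint : H3 := ⟨(0, 1), one_pos⟩

/-- The determinant gives `1 ≤ M (|c| + |d|)`, which bounds `|c|² + |d|²` below by `1 / (2M²)`; the
other bounds are direct. -/
theorem poincareExt_basePoint_mem_box {A : SL(2, ℂ)} {M : ℝ} (hM : ∀ i j, ‖A i j‖ ≤ M) :
    ‖(poincareExt A basePoint).1.1‖ ≤ 4 * M ^ 4 ∧ 1 / (2 * M ^ 2) ≤ (poincareExt A basePoint).1.2 ∧
      (poincareExt A basePoint).1.2 ≤ 2 * M ^ 2 := by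
  have hM0 : 0 ≤ M := (norm_nonneg _).trans (hM 0 0)
  have hden : denom A basePoint = ‖A 1 1‖ ^ 2 + ‖A 1 0‖ ^ 2 := by
    simp [denom, basePoint, Complex.normSq_eq_norm_sq]
  have hpos := denom_pos A basePoint
  have hle : denom A basePoint ≤ 2 * M ^ 2 := by
    rw [hden]
    have h1 := pow_le_pow_left₀ (norm_nonneg _) (hM 1 1) 2
    have h2 := pow_le_pow_left₀ (norm_nonneg _) (hM 1 0) 2
    linarith
  have hge : 1 ≤ 2 * M ^ 2 * denom A basePoint := by
    have h1 : (1 : ℝ) ≤ M * (‖A 1 1‖ + ‖A 1 0‖) := by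
      calc (1 : ℝ) = ‖A 0 0 * A 1 1 - A 0 1 * A 1 0‖ := by rw [sl_det]; simp
        _ ≤ ‖A 0 0‖ * ‖A 1 1‖ + ‖A 0 1‖ * ‖A 1 0‖ := by
          rw [← norm_mul, ← norm_mul]; exact norm_sub_le _ _
        _ ≤ M * ‖A 1 1‖ + M * ‖A 1 0‖ := by gcongr <;> apply hM
        _ = _ := by ring
    have h2 : 1 ≤ (M * (‖A 1 1‖ + ‖A 1 0‖)) ^ 2 := one_le_pow₀ h1
    have h3 : 0 ≤ M ^ 2 * (‖A 1 1‖ - ‖A 1 0‖) ^ 2 := by positivity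
    rw [hden]
    linarith
  have ht : (poincareExt A basePoint).1.2 = 1 / denom A basePoint := rfl
  have ht2 : 1 / denom A basePoint ≤ 2 * M ^ 2 := by rwa [div_le_iff₀ hpos]
  refine ⟨?_, ?_, ht ▸ ht2⟩
  · have hz : (poincareExt A basePoint).1.1 =
        (A 0 1 * star (A 1 1) + A 0 0 * star (A 1 0)) / (denom A basePoint : ℂ) := by
      simp [poincareExt, basePoint]
    have hnum : ‖A 0 1 * star (A 1 1) + A 0 0 * star (A 1 0)‖ ≤ 2 * M ^ 2 := by
      refine (norm_add_le _ _).trans ?_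
      rw [norm_mul, norm_mul, norm_star, norm_star]
      nlinarith [mul_le_mul (hM 0 1) (hM 1 1) (norm_nonneg _) hM0,
        mul_le_mul (hM 0 0) (hM 1 0) (norm_nonneg _) hM0]
    rw [hz, norm_div, Complex.norm_real, Real.norm_of_nonneg hpos.le, div_eq_mul_one_div]
    calc _ ≤ (2 * M ^ 2) * (2 * M ^ 2) := by gcongr
      _ = _ := by ring
  · rw [ht]
    exact one_div_le_one_div_of_le hpos hle

/-- Rounding down the real coordinates in the basis `1, ω` leaves two fractional parts, each
contributing at most 1. -/
theorem exists_floor_coeffs (z : ℂ) : ∃ a b : ℤ, ‖z - (a + b * ω)‖ ≤ 2 := by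
  set y : ℝ := z.im / (√3 / 2) with hy
  set x : ℝ := z.re - y / 2 with hx
  have h3 : (√3 / 2 : ℝ) ≠ 0 := by positivity
  have hz : z = x + y * ω := by
    apply Complex.ext
    · simp [ω_re, hx]
      ring
    · simp only [Complex.add_im, Complex.ofReal_im, Complex.im_ofReal_mul, ω_im, hy]
      field_simp
      ring
  refine ⟨⌊x⌋, ⌊y⌋, ?_⟩
  have h1 : z - (⌊x⌋ + ⌊y⌋ * ω) = (Int.fract x : ℝ) + (Int.fract y : ℝ) * ω := by
    rw [← Int.self_sub_floor, ← Int.self_sub_floor]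
    push_cast
    linear_combination hz
  have hω : ‖ω‖ = 1 := by rw [Complex.norm_def, normSq_ω, Real.sqrt_one]
  rw [h1]
  refine (norm_add_le _ _).trans ?_
  rw [norm_mul, hω, mul_one, Complex.norm_real, Complex.norm_real,
    Real.norm_of_nonneg (Int.fract_nonneg _), Real.norm_of_nonneg (Int.fract_nonneg _)]
  linarith [Int.fract_lt_one x, Int.fract_lt_one y]

section Discrete

variable [ProperlyDiscontinuousSMul Γ522333 H3]

theorem finite_bounded (M : ℝ) :
    {A : SL(2, ℂ) | toPSL A ∈ Γ522333 ∧ ∀ i j, ‖A i j‖ ≤ M}.Finite := by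
  rcases le_or_gt M 0 with hM | hM
  · refine Set.Finite.subset Set.finite_empty ?_
    rintro A ⟨-, hA⟩
    have h0 : ∀ i j, A i j = 0 := fun i j ↦ norm_le_zero_iff.mp ((hA i j).trans hM)
    have := sl_det A
    simp [h0] at this
  have hfin := ProperlyDiscontinuousSMul.finite_disjoint_inter_image (Γ := Γ522333)
    (isCompact_singleton (x := basePoint))
    (isCompact_box (a := 4 * M ^ 4) (b := 1 / (2 * M ^ 2)) (c := 2 * M ^ 2) (by positivity))
  refine (finite_preimage_toPSL (hfin.image Subtype.val)).subset ?_
  rintro A ⟨hA, hAM⟩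
  exact ⟨⟨_, hA⟩, ⟨_, ⟨_, rfl, rfl⟩, poincareExt_basePoint_mem_box hAM⟩, rfl⟩

/-- A special case of the Shimizu-Leutbecher lemma. -/
theorem one_le_norm_of_ne_zero {A : SL(2, ℂ)} (hA : toPSL A ∈ Γ522333) (hc : A 1 0 ≠ 0) :
    1 ≤ ‖A 1 0‖ := by
  by_contra! hlt
  set r := ‖A 1 0‖ with hr
  have hr0 : 0 ≤ r := norm_nonneg _
  -- This `M` satisfies `1 + M r ≤ M`, which keeps the bounds defining `S` stable under `B ↦ B T
  -- B⁻¹` for the unit translation `T`. That map squares the modulus of the lower left entry, so a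
  -- minimum in the finite set `S` below 1 is impossible.
  set M := max ‖A 0 0‖ (1 / (1 - r)) with hMdef
  have hMr : 1 + M * r ≤ M := by
    have h1 : 1 / (1 - r) ≤ M := le_max_right _ _
    rw [div_le_iff₀ (by linarith)] at h1
    linarith
  have hM0 : 0 ≤ M := (norm_nonneg _).trans (le_max_left _ _)
  have hM1 : 1 ≤ M := by nlinarith
  let S : Set SL(2, ℂ) := {B | toPSL B ∈ Γ522333 ∧ B 1 0 ≠ 0 ∧ ‖B 1 0‖ ≤ r ∧ ‖B 0 0‖ ≤ M ∧
    ‖B 0 1‖ ≤ M ^ 2 ∧ ‖B 1 1‖ ≤ 1 + M}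
  have hS : S.Finite := by
    refine (finite_bounded (1 + M + M ^ 2)).subset ?_
    rintro B ⟨h1, -, h2, h3, h4, h5⟩
    refine ⟨h1, fun i j ↦ ?_⟩
    have : 0 ≤ M ^ 2 := by positivity
    fin_cases i <;> fin_cases j <;> simp only [Fin.zero_eta, Fin.mk_one] <;> linarith
  have hstep : ∀ B : SL(2, ℂ), toPSL B ∈ Γ522333 → B 1 0 ≠ 0 → ‖B 1 0‖ ≤ r → ‖B 0 0‖ ≤ M →
      B * translation 1 * B⁻¹ ∈ S ∧ ‖(B * translation 1 * B⁻¹) 1 0‖ = ‖B 1 0‖ ^ 2 := by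
    intro B hB h0 h1 h2
    have hdet := sl_det B
    obtain ⟨i1, i2, i3, i4⟩ := sl_inv B
    have e00 : (B * translation 1 * B⁻¹) 0 0 = 1 - B 0 0 * B 1 0 := by
      simp only [sl_mul_apply, i1, i3, trans_apply]; linear_combination hdet
    have e01 : (B * translation 1 * B⁻¹) 0 1 = B 0 0 ^ 2 := by
      simp only [sl_mul_apply, i2, i4, trans_apply]; ring
    have e10 : (B * translation 1 * B⁻¹) 1 0 = -B 1 0 ^ 2 := by
      simp only [sl_mul_apply, i1, i3, trans_apply]; ring
    have e11 : (B * translation 1 * B⁻¹) 1 1 = 1 + B 0 0 * B 1 0 := by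
      simp only [sl_mul_apply, i2, i4, trans_apply]; linear_combination hdet
    have hprod : ‖B 0 0 * B 1 0‖ ≤ M * r := by
      rw [norm_mul]; gcongr
    have hc2 : ‖(B * translation 1 * B⁻¹) 1 0‖ = ‖B 1 0‖ ^ 2 := by rw [e10, norm_neg, norm_pow]
    refine ⟨⟨?_, ?_, ?_, ?_, ?_, ?_⟩, hc2⟩
    · rw [map_mul, map_mul, map_inv]
      exact Γ522333.mul_mem (Γ522333.mul_mem hB toPSL_trans_one_mem) (Γ522333.inv_mem hB)
    · rw [e10]
      exact neg_ne_zero.mpr (pow_ne_zero _ h0)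
    · rw [hc2]
      nlinarith [norm_nonneg (B 1 0)]
    · rw [e00]
      refine (norm_sub_le _ _).trans ?_
      rw [norm_one]
      linarith
    · rw [e01, norm_pow]
      gcongr
    · rw [e11]
      refine (norm_add_le _ _).trans ?_
      rw [norm_one]
      nlinarith
  obtain ⟨B, hB, hmin⟩ := S.exists_min_image (fun B ↦ ‖B 1 0‖) hS
    ⟨_, (hstep A hA hc le_rfl (le_max_left _ _)).1⟩
  obtain ⟨h1, h2⟩ := hstep B hB.1 hB.2.1 hB.2.2.1 hB.2.2.2.1
  have h3 := hmin _ h1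
  have h4 : 0 < ‖B 1 0‖ := norm_pos_iff.mpr hB.2.1
  have h5 : ‖B 1 0‖ < 1 := hB.2.2.1.trans_lt hlt
  simp only [h2] at h3
  nlinarith

/-- Conjugation multiplies translation lengths by the square of the upper left entry. If that entry
had modulus below 1, a shortest nonzero translation could be shortened; the inverse matrix excludes
modulus above 1. -/
theorem norm_eq_one_of_upper {A : SL(2, ℂ)} (hA : toPSL A ∈ Γ522333) (hc : A 1 0 = 0) :
    ‖A 0 0‖ = 1 := by
  have key : ∀ B : SL(2, ℂ), toPSL B ∈ Γ522333 → B 1 0 = 0 → 1 ≤ ‖B 0 0‖ := by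
    intro B hB hBc
    by_contra! hlt
    have hdet := sl_det B
    rw [hBc, mul_zero, sub_zero] at hdet
    have h0 : B 0 0 ≠ 0 := left_ne_zero_of_mul_eq_one hdet
    obtain ⟨i1, i2, i3, i4⟩ := sl_inv B
    let S : Set SL(2, ℂ) := {C | toPSL C ∈ Γ522333 ∧ ∃ β, β ≠ 0 ∧ ‖β‖ ≤ 1 ∧ C = translation β}
    have hS : S.Finite := by
      refine (finite_bounded 1).subset ?_
      rintro _ ⟨h1, β, -, h2, rfl⟩
      refine ⟨h1, fun i j ↦ ?_⟩
      fin_cases i <;> fin_cases j <;> simp [h2]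
    obtain ⟨_, ⟨hC, β, hβ0, hβ1, rfl⟩, hmin⟩ := S.exists_min_image (fun B ↦ ‖B 0 1‖) hS
      ⟨_, toPSL_trans_one_mem, 1, one_ne_zero, by simp, rfl⟩
    have hconj : B * translation β * B⁻¹ = translation (B 0 0 ^ 2 * β) := by
      apply sl_ext <;> simp only [sl_mul_apply, i1, i2, i3, i4, trans_apply, hBc]
      · linear_combination hdet
      · ring
      · ring
      · linear_combination hdet
    have hlt2 : ‖B 0 0 ^ 2 * β‖ < ‖β‖ := by
      rw [norm_mul, norm_pow]
      have : ‖B 0 0‖ ^ 2 < 1 := pow_lt_one₀ (norm_nonneg _) hlt two_ne_zero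
      nlinarith [norm_pos_iff.mpr hβ0]
    have h1 := hmin (translation (B 0 0 ^ 2 * β)) ⟨?_, _, mul_ne_zero (pow_ne_zero _ h0) hβ0,
      hlt2.le.trans hβ1, rfl⟩
    · simp only [trans_apply] at h1
      linarith
    · rw [← hconj, map_mul, map_mul, map_inv]
      exact Γ522333.mul_mem (Γ522333.mul_mem hB hC) (Γ522333.inv_mem hB)
  have h1 := key A hA hc
  obtain ⟨i1, i2, i3, i4⟩ := sl_inv A
  have h2 := key A⁻¹ (by rw [map_inv]; exact Γ522333.inv_mem hA) (by rw [i3, hc, neg_zero])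
  rw [i1] at h2
  have hdet := congrArg norm (sl_det A)
  rw [hc, mul_zero, sub_zero, norm_mul, norm_one] at hdet
  nlinarith

/-- After subtracting a known lattice translation only the part multiplied by `u` remains. Reduced
modulo `ℤ[ω]`, its multiples stay bounded, so discreteness makes two of them coincide, and linear
independence kills that part. -/
theorem exists_of_trans_mem {β : ℂ} (hβ : toPSL (translation β) ∈ Γ522333) :
    ∃ m p : ℤ, β = m + p * ω := by
  obtain ⟨m, n, p, q, h⟩ : β ∈ intRing := by simpa using mem_intRing_of_mem hβ 0 1
  have hβ0 : toPSL (translation (n * u + q * u * ω)) ∈ Γ522333 := by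
    have : (n * u + q * u * ω : ℂ) = β + -(m + p * ω) := by rw [h]; ring
    rw [this, trans_add, trans_neg, map_mul, map_inv]
    exact Γ522333.mul_mem hβ (Γ522333.inv_mem (toPSL_trans_mem m p))
  choose a b hab using fun k : ℕ ↦ exists_floor_coeffs (k * (n * u + q * u * ω))
  have hmem : ∀ k, translation (k * (n * u + q * u * ω) - (a k + b k * ω)) ∈
      {A : SL(2, ℂ) | toPSL A ∈ Γ522333 ∧ ∀ i j, ‖A i j‖ ≤ 2} := by
    intro k
    constructor
    · rw [sub_eq_add_neg, trans_add, trans_neg, trans_nsmul, map_mul, map_inv, map_pow]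
      exact Γ522333.mul_mem (Γ522333.pow_mem hβ0 k) (Γ522333.inv_mem (toPSL_trans_mem _ _))
    · intro i j
      fin_cases i <;> fin_cases j <;> simp [hab k]
  have hninj : ¬ Function.Injective
      fun k : ℕ ↦ translation (k * (n * u + q * u * ω) - (a k + b k * ω)) := fun hinj ↦
    Set.infinite_of_injective_forall_mem hinj hmem (finite_bounded 2)
  simp only [Function.Injective, not_forall] at hninj
  obtain ⟨k, l, hkl, hne⟩ := hninj
  have h01 : (k * (n * u + q * u * ω) - (a k + b k * ω) : ℂ) =
      l * (n * u + q * u * ω) - (a l + b l * ω) := by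
    have := congrArg (fun A : SL(2, ℂ) ↦ A 0 1) hkl
    simpa only [trans_apply] using this
  have hzero := coeffs_eq_zero (m := a l - a k) (n := (k - l) * n) (p := b l - b k)
    (q := (k - l) * q) (by push_cast; linear_combination h01)
  have hkl0 : (k - l : ℤ) ≠ 0 := by omega
  have hn : n = 0 := by simpa [hkl0] using hzero.2.1
  have hq : q = 0 := by simpa [hkl0] using hzero.2.2.2
  exact ⟨m, p, by rw [h, hn, hq]; simp⟩

/-! ### Horoballs -/

/-- The isometries fixing the point `∞` of the boundary. -/
def FixesInfty (g : PSL(2, ℂ)) : Prop := ∃ A : SL(2, ℂ), toPSL A = g ∧ A 1 0 = 0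

theorem height_smul_of_upper {A : SL(2, ℂ)} (hA : toPSL A ∈ Γ522333) (hc : A 1 0 = 0) (p : H3) :
    (toPSL A • p).1.2 = p.1.2 := by
  have h1 := norm_eq_one_of_upper hA hc
  have hdet := congrArg norm (sl_det A)
  rw [hc, mul_zero, sub_zero, norm_mul, h1, one_mul, norm_one] at hdet
  change p.1.2 / denom A p = _
  have : denom A p = 1 := by
    simp [denom, hc, Complex.normSq_eq_norm_sq, hdet]
  rw [this, div_one]

/-- With `|c| ≥ 1` the denominator of the action is at least the squared height. -/
theorem height_smul_le_of_ne_zero {A : SL(2, ℂ)} (hA : toPSL A ∈ Γ522333) (hc : A 1 0 ≠ 0)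
    (p : H3) : (toPSL A • p).1.2 ≤ 1 / p.1.2 := by
  have h1 := one_le_norm_of_ne_zero hA hc
  have hp := p.2
  change p.1.2 / denom A p ≤ _
  rw [div_le_div_iff₀ (denom_pos A p) hp]
  have h2 : 1 ≤ Complex.normSq (A 1 0) := by
    rw [Complex.normSq_eq_norm_sq]
    exact one_le_pow₀ h1
  unfold denom
  nlinarith [Complex.normSq_nonneg (A 1 0 * p.1.1 + A 1 1), sq_nonneg p.1.2]

theorem height_smul_le {g : PSL(2, ℂ)} (hg : g ∈ Γ522333) (p : H3) :
    (g • p).1.2 ≤ max p.1.2 (1 / p.1.2) := by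
  obtain ⟨A, rfl⟩ := toPSL_surjective g
  by_cases hc : A 1 0 = 0
  · rw [height_smul_of_upper hg hc]
    exact le_max_left _ _
  · exact (height_smul_le_of_ne_zero hg hc p).trans (le_max_right _ _)

/-- The horoball of height above 1 is precisely invariant: an element moving `∞` sends it below
height 1. -/
theorem fixesInfty_of_height {g : PSL(2, ℂ)} (hg : g ∈ Γ522333) {p : H3} (hp : 1 < p.1.2)
    (hgp : 1 < (g • p).1.2) : FixesInfty g := by
  obtain ⟨A, rfl⟩ := toPSL_surjective g
  refine ⟨A, rfl, ?_⟩
  by_contra hc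
  have h1 := height_smul_le_of_ne_zero hg hc p
  have h2 : 1 / p.1.2 < 1 := by rwa [div_lt_one p.2]
  linarith

end Discrete

/-! ### The end of the quotient is a cusp -/

theorem height_trans_smul (β : ℂ) (p : H3) :
    (toPSL (translation β) • p).1.2 = p.1.2 ∧ (toPSL (translation β) • p).1.1 = p.1.1 + β := by
  constructor
  · change p.1.2 / denom _ p = _
    simp [denom]
  · change _ / _ = _
    simp [denom]

theorem continuous_height : Continuous (fun p : H3 ↦ p.1.2) := continuous_H3_val.snd

/-- The points of height two at small distance from the vertical axis. -/
theorem isCompact_height_two (a : ℝ) : IsCompact {p : H3 | ‖p.1.1‖ ≤ a ∧ p.1.2 = 2} := by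
  convert isCompact_box (a := a) (b := 2) (c := 2) two_pos using 1
  ext p
  exact and_congr_right fun _ ↦ ⟨fun h ↦ ⟨h.ge, h.le⟩, fun h ↦ le_antisymm h.2 h.1⟩

/-- Modulo a finite index subgroup, a horosphere of `Γ(5,2,2,3,3,3)` is compact. -/
theorem exists_compact_horosphere {ΓK : Subgroup PSL(2, ℂ)} (hidx : ΓK.relIndex Γ522333 ≠ 0)
    {k : PSL(2, ℂ)} (hk : k ∈ Γ522333) :
    ∃ a : ℝ, ∀ p : H3, p.1.2 = 2 → ∃ γ ∈ ΓK, ∃ q : H3, (‖q.1.1‖ ≤ a ∧ q.1.2 = 2) ∧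
      γ • k • p = k • q := by
  have hpow : ∀ β : ℂ, toPSL (translation β) ∈ Γ522333 →
      ∃ n : ℕ, n ≠ 0 ∧ ∀ m : ℕ, k * toPSL (translation (n * m * β)) * k⁻¹ ∈ ΓK := by
    intro β hβ
    obtain ⟨n, hn, -, h⟩ := Subgroup.exists_pow_mem_of_relIndex_ne_zero hidx
      (Γ522333.mul_mem (Γ522333.mul_mem hk hβ) (Γ522333.inv_mem hk))
    refine ⟨n, by omega, fun m ↦ ?_⟩
    have : k * toPSL (translation (n * m * β)) * k⁻¹ = ((k * toPSL (translation β) * k⁻¹) ^ n) ^ m := by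
      rw [← pow_mul, conj_pow, ← map_pow, ← trans_nsmul]
      push_cast
      rfl
    rw [this]
    exact ΓK.pow_mem h.1 m
  obtain ⟨n₁, hn₁, h₁⟩ := hpow 1 toPSL_trans_one_mem
  obtain ⟨n₂, hn₂, h₂⟩ := hpow ω toPSL_trans_ω_mem
  have h₁' := h₁ n₂
  have h₂' := h₂ n₁
  -- A common multiple of the two exponents, so that the conjugates by `k` of all translations by `n
  -- ℤ[ω]` lie in `ΓK`.
  set n : ℂ := n₁ * n₂ with hn
  have hn0 : n ≠ 0 := mul_ne_zero (by exact_mod_cast hn₁) (by exact_mod_cast hn₂)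
  rw [mul_comm (n₂ : ℂ), ← hn] at h₂'
  have hlat : ∀ a b : ℤ, k * toPSL (translation (n * (a + b * ω))) * k⁻¹ ∈ ΓK := by
    intro a b
    have : k * toPSL (translation (n * (a + b * ω))) * k⁻¹ =
        (k * toPSL (translation (n * 1)) * k⁻¹) ^ a * (k * toPSL (translation (n * ω)) * k⁻¹) ^ b := by
      rw [conj_zpow, conj_zpow, ← map_zpow, ← map_zpow, ← trans_zsmul, ← trans_zsmul,
        show n * (a + b * ω) = a * (n * 1) + b * (n * ω) by ring, trans_add, map_mul]
      group
    rw [this]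
    exact ΓK.mul_mem (ΓK.zpow_mem h₁' a) (ΓK.zpow_mem h₂' b)
  refine ⟨‖n‖ * 2, fun p hp ↦ ?_⟩
  obtain ⟨a, b, hab⟩ := exists_floor_coeffs (p.1.1 / n)
  refine ⟨_, hlat (-a) (-b), toPSL (translation (n * ((-a : ℤ) + (-b : ℤ) * ω))) • p, ⟨?_, ?_⟩, ?_⟩
  · rw [(height_trans_smul _ _).2]
    have : p.1.1 + n * ((-a : ℤ) + (-b : ℤ) * ω) = n * (p.1.1 / n - (a + b * ω)) := by
      field_simp
      push_cast
      ring
    rw [this, norm_mul]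
    gcongr
  · rw [(height_trans_smul _ _).1, hp]
  · simp only [← mul_smul, inv_mul_cancel_right]

theorem exists_isCompact_image_superset {X Y : Type*} [TopologicalSpace X] [TopologicalSpace Y]
    [LocallyCompactSpace X] {f : X → Y} (hf : IsOpenMap f) {Z : Set Y} (hZ : IsCompact Z)
    (hZf : Z ⊆ range f) : ∃ D : Set X, IsCompact D ∧ Z ⊆ f '' D := by
  choose C hC hxC using fun x : X ↦ exists_compact_mem_nhds x
  obtain ⟨t, ht⟩ := hZ.elim_finite_subcover (fun x ↦ f '' interior (C x))
    (fun x ↦ hf _ isOpen_interior) fun y hy ↦ by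
      obtain ⟨x, rfl⟩ := hZf hy
      exact mem_iUnion.mpr ⟨x, x, mem_interior_iff_mem_nhds.mpr (hxC x), rfl⟩
  refine ⟨⋃ x ∈ t, C x, t.isCompact_biUnion fun x _ ↦ hC x, fun y hy ↦ ?_⟩
  obtain ⟨x, hx, z, hz, rfl⟩ := mem_iUnion₂.mp (ht hy)
  exact ⟨z, mem_iUnion₂.mpr ⟨x, hx, interior_subset hz⟩, rfl⟩

/-- Compactness of the circle makes the distance from the knot to `Z` uniform in the tube
coordinate. -/
theorem exists_tube {e : Circle × ℂ → S3} (he : IsOpenEmbedding e) {Z : Set S3} (hZ : IsCompact Z)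
    (hdisj : ∀ θ, e (θ, 0) ∉ Z) : ∃ ε > 0, ∀ θ z, ‖z‖ < ε → e (θ, z) ∉ Z := by
  have hU : IsOpen (e ⁻¹' Zᶜ) := hZ.isClosed.isOpen_compl.preimage he.continuous
  obtain ⟨A, B, -, hB, hA1, hB0, hAB⟩ := generalized_tube_lemma (isCompact_univ (X := Circle))
    (isCompact_singleton (x := (0 : ℂ))) hU (by rintro ⟨θ, z⟩ ⟨-, rfl⟩; exact hdisj θ)
  obtain ⟨ε, hε, hball⟩ := Metric.isOpen_iff.mp hB 0 (hB0 rfl)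
  exact ⟨ε, hε, fun θ z hz ↦ hAB ⟨hA1 (mem_univ θ), hball (by simpa using hz)⟩⟩

theorem norm_exp_lt_of_re_lt {ε : ℝ} (hε : 0 < ε) {w : ℂ} (hw : w.re < Real.log ε) :
    ‖Complex.exp w‖ < ε := by
  rw [Complex.norm_exp]
  exact (Real.lt_log_iff_exp_lt hε).mp hw

/-- Every cusp of `Γ(5,2,2,3,3,3)` contains the end of the knot complement. -/
theorem exists_horoball_of_lift [ProperlyDiscontinuousSMul Γ522333 H3] {ΓK : Subgroup PSL(2, ℂ)}
    (hle : ΓK ≤ Γ522333) (hidx : ΓK.relIndex Γ522333 ≠ 0)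
    {π : H3 → S3} {e : Circle × ℂ → S3} {L : ℝ × ℂ → H3}
    (hπ : Continuous π) (hopen : IsOpenMap π) (hfib : ∀ x y, π x = π y ↔ ∃ γ : ΓK, γ • x = y)
    (he : IsOpenEmbedding e) (hrange : range π = (e '' {p | p.2 = 0})ᶜ) (hL : Continuous L)
    (hLπ : ∀ s w, π (L (s, w)) = e (Circle.exp s, Complex.exp w))
    {k : PSL(2, ℂ)} (hk : k ∈ Γ522333) :
    ∃ R : ℝ, ∃ γ ∈ ΓK, ∀ s w, w.re < R → 2 < ((γ * k)⁻¹ • L (s, w)).1.2 := by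
  have hne : ∀ x θ, π x ≠ e (θ, 0) := by
    intro x θ hx
    have : π x ∈ (e '' {p | p.2 = 0})ᶜ := hrange ▸ mem_range_self x
    exact this ⟨_, rfl, hx.symm⟩
  obtain ⟨a, ha⟩ := exists_compact_horosphere hidx hk
  have hC : IsCompact (π '' ((k • ·) '' {p : H3 | ‖p.1.1‖ ≤ a ∧ p.1.2 = 2})) :=
    ((isCompact_height_two a).image (continuous_const_smul k)).image hπ
  obtain ⟨ε, hε, hεC⟩ := exists_tube he hC (by
    rintro θ ⟨x, -, hx⟩
    exact hne x θ hx)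
  -- the lift avoids the horospheres
  have havoid : ∀ γ ∈ ΓK, ∀ s w, w.re < Real.log ε → ((γ * k)⁻¹ • L (s, w)).1.2 ≠ 2 := by
    intro γ hγ s w hw h2
    obtain ⟨δ, hδ, q, hq, hqp⟩ := ha _ h2
    refine hεC (Circle.exp s) (Complex.exp w) (norm_exp_lt_of_re_lt hε hw)
      ⟨_, ⟨q, hq, rfl⟩, ?_⟩
    rw [← hLπ, eq_comm, hfib]
    refine ⟨⟨δ * γ⁻¹, ΓK.mul_mem hδ (ΓK.inv_mem hγ)⟩, ?_⟩
    change (δ * γ⁻¹) • L (s, w) = k • q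
    rw [← hqp, ← mul_smul, ← mul_smul]
    congr 1
    group
  -- the lift meets a horoball
  have hmeet : ∃ γ ∈ ΓK, ∃ s w, w.re < Real.log ε ∧ 2 < ((γ * k)⁻¹ • L (s, w)).1.2 := by
    by_contra! hcon
    have hZ : IsCompact (e '' {p | ‖p.2‖ < ε})ᶜ := by
      refine IsClosed.isCompact (IsOpen.isClosed_compl (he.isOpenMap _ ?_))
      exact isOpen_lt continuous_snd.norm continuous_const
    have hZπ : (e '' {p | ‖p.2‖ < ε})ᶜ ⊆ range π := by
      rw [hrange]
      refine compl_subset_compl.mpr (image_mono fun p hp ↦ ?_)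
      change ‖p.2‖ < ε
      rwa [show p.2 = 0 from hp, norm_zero]
    obtain ⟨D, hD, hZD⟩ := exists_isCompact_image_superset hopen hZ hZπ
    obtain ⟨B, hB⟩ := (hD.image ((continuous_height.max
      (continuous_const.div continuous_height fun p ↦ p.2.ne')) :
        Continuous fun p : H3 ↦ max p.1.2 (1 / p.1.2))).bddAbove
    -- Up to `ΓK`, every point outside the tube comes from the compact set `D`, and elements of
    -- `Γ522333` raise a height `t` to at most `max t (1 / t)`, hence to at most `B` on `D`. A point
    -- of greater height must therefore map into the tube.
    let p : H3 := ⟨(0, max 3 (B + 1)), lt_of_lt_of_le (by norm_num) (le_max_left _ _)⟩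
    have hp3 : 2 < p.1.2 := lt_of_lt_of_le (by norm_num) (le_max_left 3 (B + 1))
    have hpB : B < p.1.2 := lt_of_lt_of_le (by linarith) (le_max_right 3 (B + 1))
    by_cases hp : π (k • p) ∈ e '' {p | ‖p.2‖ < ε}
    · obtain ⟨⟨θ, z⟩, hz, hzp⟩ := hp
      have hz0 : z ≠ 0 := by
        rintro rfl
        exact hne _ _ hzp.symm
      have hexp := Circle.exp_arg θ
      obtain ⟨γ, hγ⟩ := (hfib (k • p) (L (Complex.arg θ, Complex.log z))).mp
        (by rw [hLπ, Complex.exp_log hz0, hexp, hzp])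
      refine absurd (hcon γ γ.2 (Complex.arg θ) (Complex.log z) ?_) (not_le.mpr ?_)
      · rw [Complex.log_re]
        exact Real.log_lt_log (norm_pos_iff.mpr hz0) hz
      · rw [← hγ]
        change 2 < (((γ : PSL(2, ℂ)) * k)⁻¹ • (γ : PSL(2, ℂ)) • k • p).1.2
        rw [← mul_smul (γ : PSL(2, ℂ)), inv_smul_smul]
        exact hp3
    · obtain ⟨d, hd, hdp⟩ := hZD hp
      obtain ⟨γ, hγ⟩ := (hfib _ _).mp hdp
      have h1 : p = (k⁻¹ * γ) • d := by
        rw [mul_smul, eq_inv_smul_iff]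
        exact hγ.symm
      have h2 := height_smul_le (Γ522333.mul_mem (Γ522333.inv_mem hk) (hle γ.2)) d
      rw [← h1] at h2
      exact absurd (hB ⟨d, hd, rfl⟩) (not_le.mpr (hpB.trans_le h2))
  obtain ⟨γ, hγ, s₀, w₀, hw₀, h₀⟩ := hmeet
  refine ⟨Real.log ε, γ, hγ, fun s w hw ↦ ?_⟩
  by_contra! hlt
  have hpre : IsPreconnected ((univ : Set ℝ) ×ˢ {w : ℂ | w.re < Real.log ε}) :=
    isPreconnected_univ.prod (convex_halfSpace_re_lt _).isPreconnected
  have hcont : Continuous fun x : ℝ × ℂ ↦ ((γ * k)⁻¹ • L x).1.2 :=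
    continuous_height.comp ((continuous_const_smul (γ * k)⁻¹).comp hL)
  obtain ⟨⟨s', w'⟩, ⟨-, hw'⟩, h'⟩ := hpre.intermediate_value (a := (s, w)) (b := (s₀, w₀))
    ⟨mem_univ _, hw⟩ ⟨mem_univ _, hw₀⟩ hcont.continuousOn ⟨hlt, h₀.le⟩
  exact havoid γ hγ s' w' hw' h'

/-- A knot group in `Γ(5,2,2,3,3,3)` is normally generated by an element conjugate to one fixing
`∞`, and contains an element carrying `∞` to `0`. -/
theorem exists_meridian_fixesInfty [ProperlyDiscontinuousSMul Γ522333 H3]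
    {ΓK : Subgroup PSL(2, ℂ)} (hK : IsKnotGroup ΓK)
    (hle : ΓK ≤ Γ522333) (hidx : ΓK.relIndex Γ522333 ≠ 0) :
    ∃ μ : ΓK, FixesInfty μ ∧ (∀ N : Subgroup ΓK, N.Normal → μ ∈ N → N = ⊤) ∧
      ∃ γ ∈ ΓK, FixesInfty (γ⁻¹ * toPSL inversion) := by
  obtain ⟨π, e, L, μ, hπ, hopen, hfib, he, hrange, hL, hLπ, hμ, hN⟩ := hK.exists_covering
  obtain ⟨R₁, γ₁, hγ₁, h₁⟩ := exists_horoball_of_lift hle hidx hπ hopen hfib he hrange hL hLπ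
    Γ522333.one_mem
  obtain ⟨R₂, γ₂, hγ₂, h₂⟩ := exists_horoball_of_lift hle hidx hπ hopen hfib he hrange hL hLπ
    toPSL_flip_mem
  simp only [mul_one] at h₁
  let w : ℂ := (min R₁ R₂ - 1 : ℝ)
  have hw₁ : w.re < R₁ := by
    simp only [w, Complex.ofReal_re]; linarith [min_le_left R₁ R₂]
  have hw₂ : w.re < R₂ := by
    simp only [w, Complex.ofReal_re]; linarith [min_le_right R₁ R₂]
  refine ⟨⟨γ₁, hγ₁⟩⁻¹ * μ * ⟨γ₁, hγ₁⟩, ?_, fun N hNn hmem ↦ hN N hNn ?_, γ₂⁻¹ * γ₁, ?_, ?_⟩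
  · refine fixesInfty_of_height (p := γ₁⁻¹ • L (0, w))
      (hle (ΓK.mul_mem (ΓK.mul_mem (ΓK.inv_mem hγ₁) μ.2) hγ₁)) ?_ ?_
    · linarith [h₁ 0 w hw₁]
    · have h3 := h₁ 0 (w + 2 * Real.pi * Complex.I) (by simpa using hw₁)
      rw [hμ] at h3
      change 1 < ((γ₁⁻¹ * μ * γ₁) • γ₁⁻¹ • L (0, w)).1.2
      rw [← mul_smul, mul_inv_cancel_right, mul_smul]
      exact one_lt_two.trans h3
  · have := hNn.conj_mem _ hmem ⟨γ₁, hγ₁⟩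
    simpa [mul_assoc] using this
  · exact ΓK.mul_mem (ΓK.inv_mem hγ₂) hγ₁
  · have h3 : (γ₂⁻¹ * γ₁)⁻¹ * toPSL inversion = γ₁⁻¹ * (γ₂ * toPSL inversion) := by group
    rw [h3]
    refine fixesInfty_of_height (p := (γ₂ * toPSL inversion)⁻¹ • L (0, w))
      (Γ522333.mul_mem (Γ522333.inv_mem (hle hγ₁)) (Γ522333.mul_mem (hle hγ₂) toPSL_flip_mem))
      ?_ ?_
    · linarith [h₂ 0 w hw₂]
    · rw [mul_smul, smul_inv_smul]
      linarith [h₁ 0 w hw₁]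

/-! ### Meridians are units -/

/-- The map from `SL(2, ℤ[u, ω])` to `PSL(2, ℂ)`. -/
noncomputable def ofIntRing : SL(2, intRing) →* PSL(2, ℂ) :=
  toPSL.comp (Matrix.SpecialLinearGroup.map intRing.subtype)

theorem exists_ofIntRing_eq {g : PSL(2, ℂ)} (hg : g ∈ Γ522333) : ∃ C, ofIntRing C = g := by
  obtain ⟨A, rfl⟩ := toPSL_surjective g
  have hA := mem_intRing_of_mem hg
  refine ⟨⟨Matrix.of fun i j ↦ ⟨A i j, hA i j⟩, ?_⟩, ?_⟩
  · apply Subtype.ext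
    rw [Matrix.det_fin_two]
    exact sl_det A
  · change toPSL _ = toPSL A
    congr 1

/-- The image in `PSL(2, ℂ)` of the principal congruence subgroup modulo `β`. -/
noncomputable def congruenceSubgroup (β : intRing) : Subgroup PSL(2, ℂ) :=
  (Matrix.SpecialLinearGroup.map (n := Fin 2) (Ideal.Quotient.mk (Ideal.span {β}))).ker.map
    ofIntRing

/-- A kernel is normal in the integral special linear group, to which every element of `Γ522333`
lifts. -/
theorem congruenceSubgroup_subgroupOf_normal {ΓK : Subgroup PSL(2, ℂ)} (hle : ΓK ≤ Γ522333)
    (β : intRing) : ((congruenceSubgroup β).subgroupOf ΓK).Normal := by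
  constructor
  rintro n ⟨C, hC, hCn⟩ g
  obtain ⟨D, hD⟩ := exists_ofIntRing_eq (hle g.2)
  refine ⟨D * C * D⁻¹, (MonoidHom.normal_ker _).conj_mem C hC D, ?_⟩
  rw [map_mul, map_mul, map_inv, hCn, hD]
  rfl

theorem trans_mem_congruenceSubgroup (β : intRing) : toPSL (translation β) ∈ congruenceSubgroup β := by
  have hβ : Ideal.Quotient.mk (Ideal.span {β}) β = 0 :=
    Ideal.Quotient.eq_zero_iff_mem.mpr (Ideal.mem_span_singleton_self β)
  let C : SL(2, intRing) := ⟨!![1, β; 0, 1], by simp [Matrix.det_fin_two]⟩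
  refine ⟨C, MonoidHom.mem_ker.mpr ?_, congrArg toPSL ?_⟩
  · apply Matrix.SpecialLinearGroup.ext
    intro i j
    change Ideal.Quotient.mk _ (!![1, β; 0, 1] i j) = (1 : Matrix (Fin 2) (Fin 2) _) i j
    fin_cases i <;> fin_cases j <;> simp [hβ]
  · apply Matrix.SpecialLinearGroup.ext
    intro i j
    change ((!![1, β; 0, 1] i j : intRing) : ℂ) = translation β i j
    fin_cases i <;> fin_cases j <;> simp

theorem exists_eq_mul_of_mem_congruenceSubgroup {β : intRing} {A : SL(2, ℂ)}
    (hA : toPSL A ∈ congruenceSubgroup β) : ∃ δ ∈ intRing, A 1 0 = β * δ := by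
  obtain ⟨C, hC, hCA⟩ := hA
  have h1 : Ideal.Quotient.mk (Ideal.span {β}) (C 1 0) = 0 := by
    rw [SetLike.mem_coe, MonoidHom.mem_ker] at hC
    have := congrArg (fun B : SL(2, intRing ⧸ Ideal.span {β}) ↦ B 1 0) hC
    simpa using this
  obtain ⟨δ, hδ⟩ := Ideal.mem_span_singleton'.mp (Ideal.Quotient.eq_zero_iff_mem.mp h1)
  obtain ⟨ε, hε, h⟩ := toPSL_eq_iff.mp (show toPSL _ = toPSL A from hCA)
  have h2 : A 1 0 = ε * (C 1 0 : ℂ) := h 1 0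
  have hεm : ε ∈ intRing := by
    rcases sq_eq_sq_iff_eq_or_eq_neg.mp (hε.trans (one_pow 2).symm) with rfl | rfl
    · exact intRing.one_mem
    · exact intRing.neg_mem intRing.one_mem
  refine ⟨ε * δ, intRing.mul_mem hεm δ.2, ?_⟩
  rw [h2, ← hδ]
  push_cast
  ring

/-! ### Parabolic elements fixing `0` -/

/-- The lower triangular parabolic matrix with lower left entry `x`. -/
def lowerTrans (x : ℂ) : SL(2, ℂ) := sl !![1, 0; x, 1] (by simp [Matrix.det_fin_two])

theorem conj_trans_of_zero {C : SL(2, ℂ)} (hC : C 0 0 = 0) :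
    C * translation 1 * C⁻¹ = lowerTrans (-C 1 0 ^ 2) := by
  have hdet := sl_det C
  obtain ⟨i1, i2, i3, i4⟩ := sl_inv C
  rw [hC] at hdet
  apply sl_ext <;> simp only [sl_mul_apply, i1, i2, i3, i4, trans_apply, hC] <;>
    simp [lowerTrans, sl]
  · linear_combination hdet
  · ring
  · linear_combination hdet

theorem rot_pow_mul_trans (j : ℕ) (β : ℂ) :
    rotation ^ j * translation β = translation (((ω ^ 2)⁻¹) ^ j * β) * rotation ^ j := by
  induction j with
  | zero => simp
  | succ j ih =>
    rw [pow_succ', mul_assoc, ih, ← mul_assoc, rot_mul_trans, mul_assoc]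
    congr 2
    ring

theorem rot_pow_apply (j : ℕ) : (rotation ^ j) 0 0 = ω⁻¹ ^ j ∧ (rotation ^ j) 0 1 = 0 ∧
    (rotation ^ j) 1 0 = 0 ∧ (rotation ^ j) 1 1 = ω ^ j := by
  induction j with
  | zero => simp
  | succ j ih =>
    obtain ⟨h1, h2, h3, h4⟩ := ih
    refine ⟨?_, ?_, ?_, ?_⟩ <;> rw [pow_succ, sl_mul_apply] <;> simp [h1, h2, h3, h4, pow_succ]

/-- The product of the two parabolic elements `ζ ↦ ζ + 1` and `ζ ↦ ζ / (1 - u² ζ)` is elliptic. -/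
theorem exists_fixed_point : ∃ p : H3, toPSL (translation 1 * lowerTrans (-u ^ 2)) • p = p := by
  obtain ⟨φ, hφdef⟩ : ∃ φ, φ = Real.goldenRatio := ⟨_, rfl⟩
  have hφ : φ ^ 2 = φ + 1 := hφdef ▸ Real.goldenRatio_sq
  have hpos : 0 < φ := hφdef ▸ Real.goldenRatio_pos
  have hu : u = (φ : ℂ) := by rw [hφdef]; rfl
  have ht : 0 < √(2 + φ) / (2 * φ ^ 2) := by positivity
  -- The boundary fixed points solve `φ²ζ² - φ²ζ + 1 = 0`. They are complex conjugates with real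
  -- part `1/2`, and this point is the top of the semicircular axis joining them.
  let p : H3 := ⟨((1 / 2 : ℝ), √(2 + φ) / (2 * φ ^ 2)), ht⟩
  have e00 : (translation 1 * lowerTrans (-u ^ 2)) 0 0 = (-φ : ℝ) := by
    rw [sl_mul_apply]
    simp only [lowerTrans, sl, trans_apply, Matrix.of_apply, Matrix.cons_val', Matrix.cons_val_zero,
      Matrix.cons_val_one, Matrix.cons_val_fin_one]
    rw [u_sq, hu]
    push_cast
    ring
  have e01 : (translation 1 * lowerTrans (-u ^ 2)) 0 1 = (1 : ℝ) := by
    rw [sl_mul_apply]; simp [lowerTrans, sl]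
  have e10 : (translation 1 * lowerTrans (-u ^ 2)) 1 0 = (-φ ^ 2 : ℝ) := by
    rw [sl_mul_apply]; simp [lowerTrans, sl, hu]
  have e11 : (translation 1 * lowerTrans (-u ^ 2)) 1 1 = (1 : ℝ) := by
    rw [sl_mul_apply]; simp [lowerTrans, sl]
  have ht2 : (√(2 + φ) / (2 * φ ^ 2)) ^ 2 = (2 + φ) / (4 * φ ^ 4) := by
    rw [div_pow, Real.sq_sqrt (by positivity)]
    ring
  have hd : denom (translation 1 * lowerTrans (-u ^ 2)) p = 1 := by
    unfold denom
    rw [e10, e11]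
    simp only [p, ← Complex.ofReal_mul, ← Complex.ofReal_add, Complex.normSq_ofReal, ht2]
    have h4 : -φ ^ 2 * -φ ^ 2 * ((2 + φ) / (4 * φ ^ 4)) = (2 + φ) / 4 := by field_simp
    rw [h4]
    linear_combination ((φ ^ 2 + φ - 2) / 4) * hφ
  have hz : (-φ * (1 / 2) + 1) * (-φ ^ 2 * (1 / 2) + 1) +
      -φ * -φ ^ 2 * ((2 + φ) / (4 * φ ^ 4)) = 1 / 2 := by
    field_simp
    linear_combination 4 * (φ ^ 2 - φ - 2) * hφ
  refine ⟨p, Subtype.ext (Prod.ext ?_ ?_)⟩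
  · change _ / (denom (translation 1 * lowerTrans (-u ^ 2)) p : ℂ) = _
    have hst : ∀ r : ℝ, star (r : ℂ) = r := Complex.conj_ofReal
    rw [hd, Complex.ofReal_one, div_one, e00, e01, e10, e11]
    simp only [p, ← Complex.ofReal_mul, ← Complex.ofReal_add, hst, ← Complex.ofReal_pow, ht2]
    exact congrArg _ hz
  · change p.1.2 / denom (translation 1 * lowerTrans (-u ^ 2)) p = p.1.2
    rw [hd, div_one]

/-! ### Upper triangular elements of the group -/

section

variable [ProperlyDiscontinuousSMul Γ522333 H3]

theorem exists_ω_pow_of_upper {A : SL(2, ℂ)} (hA : toPSL A ∈ Γ522333) (hc : A 1 0 = 0) :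
    ∃ k : ℕ, A 0 0 = ω ^ k := by
  refine eq_ω_pow_of_normSq_eq_one (mem_intRing_of_mem hA 0 0) ?_
  rw [Complex.normSq_eq_norm_sq, norm_eq_one_of_upper hA hc, one_pow]

/-- An upper triangular element generating a free cyclic action is a translation. -/
theorem exists_eq_trans {g : PSL(2, ℂ)} (hg : g ∈ Γ522333) (hfree : ∀ p : H3, g • p = p → g = 1)
    (hfix : FixesInfty g) : ∃ β, g = toPSL (translation β) := by
  obtain ⟨A, rfl, hc⟩ := hfix
  have hdet := sl_det A
  rw [hc, mul_zero, sub_zero] at hdet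
  have ha0 : A 0 0 ≠ 0 := left_ne_zero_of_mul_eq_one hdet
  by_cases ha : A 0 0 ^ 2 = 1
  · refine ⟨A 0 0 * A 0 1, toPSL_eq_iff.mpr ⟨A 0 0, ha, ?_⟩⟩
    have ha' : A 0 0 * A 0 0 = 1 := by rw [← sq, ha]
    intro i j
    fin_cases i <;> fin_cases j <;> simp [hc, hdet, ha']
  · exfalso
    have h1 : 1 - A 0 0 ^ 2 ≠ 0 := sub_ne_zero.mpr (Ne.symm ha)
    -- A point above the finite fixed point of `ζ ↦ a²ζ + ab`. As `|a| = 1`, the element rotates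
    -- about this vertical axis and fixes it pointwise.
    let p : H3 := ⟨(A 0 0 * A 0 1 / (1 - A 0 0 ^ 2), 1), one_pos⟩
    have hn : ‖A 1 1‖ = 1 := by
      have := congrArg norm hdet
      rwa [norm_mul, norm_eq_one_of_upper hg hc, one_mul, norm_one] at this
    have hd : denom A p = 1 := by simp [denom, hc, Complex.normSq_eq_norm_sq, hn]
    have hstar : star (A 1 1) = A 0 0 := by
      have h2 : A 1 1 * star (A 1 1) = 1 := by
        have := Complex.mul_conj (A 1 1)
        rw [Complex.normSq_eq_norm_sq, hn] at this
        simpa using this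
      have h3 : A 1 1 ≠ 0 := right_ne_zero_of_mul_eq_one hdet
      apply mul_left_cancel₀ h3
      rw [h2, mul_comm, hdet]
    have hp : toPSL A • p = p := by
      apply Subtype.ext
      apply Prod.ext
      · change (_ / (denom A p : ℂ)) = _
        rw [hd, hc, zero_mul, zero_add, hstar]
        simp only [p, star_zero, Complex.ofReal_one]
        field_simp
        ring
      · change p.1.2 / denom A p = p.1.2
        rw [hd, div_one]
    have h2 := hfree p hp
    rw [← map_one toPSL, eq_comm] at h2
    obtain ⟨ε, hε, h⟩ := toPSL_eq_iff.mp h2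
    apply ha
    rw [h 0 0]
    simpa using hε

end

/-! ### Normalizing the meridians -/

theorem ω_sq_pow_three : (ω ^ 2) ^ 3 = 1 := by
  rw [← pow_mul]
  exact ω_pow_six

/-- Up to a rotation around the geodesic from `0` to `∞`, a knot group in `Γ(5,2,2,3,3,3)` contains
the translation by `1` and one of three parabolic elements fixing `0`. -/
theorem exists_rot_conj_meridians [ProperlyDiscontinuousSMul Γ522333 H3]
    {ΓK : Subgroup PSL(2, ℂ)} (hK : IsKnotGroup ΓK) (hle : ΓK ≤ Γ522333)
    (hidx : ΓK.relIndex Γ522333 ≠ 0) :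
    ∃ j i : ℕ, toPSL (translation 1) ∈ ΓK.map (MulAut.conj (toPSL rotation ^ j)).toMonoidHom ∧
      toPSL (lowerTrans (-(u ^ 2 * (ω ^ 2) ^ i))) ∈
        ΓK.map (MulAut.conj (toPSL rotation ^ j)).toMonoidHom := by
  obtain ⟨μ, hμ, hN, γ, hγ, S, hS, hSc⟩ := exists_meridian_fixesInfty hK hle hidx
  obtain ⟨β, hβ⟩ := exists_eq_trans (hle μ.2) (hK.free μ μ.2) hμ
  have hβΓ : toPSL (translation β) ∈ Γ522333 := hβ ▸ hle μ.2
  have hβR : β ∈ intRing := by simpa using mem_intRing_of_mem hβΓ 0 1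
  -- the element of the knot group carrying `∞` to `0`
  have hSΓ : toPSL S ∈ Γ522333 :=
    hS ▸ Γ522333.mul_mem (Γ522333.inv_mem (hle hγ)) toPSL_flip_mem
  obtain ⟨k, hk⟩ := exists_ω_pow_of_upper hSΓ hSc
  have hSd := sl_det S
  rw [hSc, mul_zero, sub_zero] at hSd
  obtain ⟨i1, i2, i3, i4⟩ := sl_inv S
  set C : SL(2, ℂ) := inversion * S⁻¹ with hCdef
  have hCγ : toPSL C = γ := by
    rw [hCdef, map_mul, map_inv, hS]
    group
  have hC00 : C 0 0 = 0 := by rw [hCdef, sl_mul_apply]; simp [i3, hSc]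
  have hC10 : C 1 0 = -ω⁻¹ * u * S 1 1 := by rw [hCdef, sl_mul_apply]; simp [i1, i3, hSc]
  -- the meridian is a unit
  have htop : (congruenceSubgroup ⟨β, hβR⟩).subgroupOf ΓK = ⊤ := by
    refine hN _ (congruenceSubgroup_subgroupOf_normal hle _) ?_
    rw [Subgroup.mem_subgroupOf, hβ]
    exact trans_mem_congruenceSubgroup ⟨β, hβR⟩
  obtain ⟨δ, hδ, hCδ⟩ := exists_eq_mul_of_mem_congruenceSubgroup (β := ⟨β, hβR⟩) (A := C)
    (hCγ ▸ Subgroup.subgroupOf_eq_top.mp htop hγ)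
  have hω0 := ω_ne_zero
  have hu0 := u_ne_zero
  -- The extra factor is the inverse of `C 1 0`, up to the form given by the determinant of `S`.
  have hunit : β * (δ * (-(ω * u⁻¹) * S 0 0)) = 1 := by
    have h1 : β * δ = C 1 0 := hCδ.symm
    rw [← mul_assoc, h1, hC10]
    field_simp
    linear_combination hSd
  obtain ⟨m, p, hmp⟩ := exists_of_trans_mem hβΓ
  have hδ' : δ * (-(ω * u⁻¹) * S 0 0) ∈ intRing :=
    intRing.mul_mem hδ (intRing.mul_mem (intRing.neg_mem (intRing.mul_mem ω_mem u_inv_mem))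
      (mem_intRing_of_mem hSΓ 0 0))
  obtain ⟨l, hl⟩ := eq_ω_pow_of_mul_eq_one hδ' (hmp ▸ hunit)
  obtain ⟨j, hj⟩ := ω_pow_eq l
  rw [← hl, ← hmp] at hj
  -- conjugation by the rotation
  have hconj : ∀ A : SL(2, ℂ), toPSL A ∈ ΓK →
      toPSL (rotation ^ j * A * (rotation ^ j)⁻¹) ∈ ΓK.map (MulAut.conj (toPSL rotation ^ j)).toMonoidHom :=
    fun A hA ↦ ⟨toPSL A, hA, by
      change toPSL rotation ^ j * toPSL A * (toPSL rotation ^ j)⁻¹ = _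
      rw [map_mul, map_mul, map_inv, map_pow]⟩
  have hone : toPSL (translation 1) ∈ ΓK.map (MulAut.conj (toPSL rotation ^ j)).toMonoidHom := by
    have h1 := hconj (translation β) (hβ ▸ μ.2)
    rw [rot_pow_mul_trans, mul_inv_cancel_right] at h1
    have hinv : ((ω ^ 2)⁻¹) ^ j * (ω ^ 2) ^ j = 1 := by
      rw [← mul_pow, inv_mul_cancel₀ (pow_ne_zero _ hω0), one_pow]
    rcases hj with hj | hj
    · rwa [hj, hinv] at h1
    · rw [hj, mul_neg, hinv, trans_neg, map_inv] at h1
      exact (Subgroup.inv_mem_iff _).mp h1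
  set D : SL(2, ℂ) := rotation ^ j * C * (rotation ^ j)⁻¹ with hD
  have hDmem := hconj C (hCγ.symm ▸ hγ)
  rw [← hD] at hDmem
  obtain ⟨r1, r2, r3, r4⟩ := rot_pow_apply j
  obtain ⟨q1, q2, q3, q4⟩ := sl_inv (rotation ^ j)
  have hD00 : D 0 0 = 0 := by
    simp only [hD, sl_mul_apply (_ * _), sl_mul_apply (rotation ^ j), q1, q3, r2, r3, hC00]
    ring
  have hD10 : D 1 0 = ω ^ j * C 1 0 * ω ^ j := by
    simp only [hD, sl_mul_apply (_ * _), sl_mul_apply (rotation ^ j), q1, q3, r3, r4]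
    ring
  -- The square of `D 1 0` is `u²` times `ω⁻²`, `ω⁻²ᵏ` and `ω⁴ʲ`. Since `ω⁶ = 1`, these are the
  -- powers `2`, `2k` and `2j` of `ω²`.
  refine ⟨j, 2 + 2 * k + 2 * j, hone, ?_⟩
  have hsq : u ^ 2 * (ω ^ 2) ^ (2 + 2 * k + 2 * j) = D 1 0 ^ 2 := by
    have h1 : (S 1 1) ^ 2 = (ω ^ 2) ^ (2 * k) := by
      have h2 : ω ^ k ≠ 0 := pow_ne_zero _ hω0
      have h3 : S 1 1 = (ω ^ k)⁻¹ := by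
        rw [← hk]
        exact eq_inv_of_mul_eq_one_right hSd
      have h4 : (ω ^ k) ^ 6 = 1 := by rw [← pow_mul, mul_comm, pow_mul, ω_pow_six, one_pow]
      rw [h3, show (ω ^ 2) ^ (2 * k) = (ω ^ k) ^ 4 by ring]
      field_simp
      exact h4.symm
    have h5 : ω⁻¹ ^ 2 = (ω ^ 2) ^ 2 := by
      field_simp
      exact ω_pow_six.symm
    rw [hD10, hC10, pow_add, pow_add, ← h1]
    linear_combination (-(u ^ 2 * S 1 1 ^ 2 * ω ^ (4 * j))) * h5
  have hlow : toPSL (lowerTrans (-(u ^ 2 * (ω ^ 2) ^ (2 + 2 * k + 2 * j)))) =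
      toPSL D * toPSL (translation 1) * (toPSL D)⁻¹ := by
    rw [← map_inv, ← map_mul, ← map_mul, conj_trans_of_zero hD00, hsq]
  rw [hlow]
  exact Subgroup.mul_mem _ (Subgroup.mul_mem _ hDmem hone) (Subgroup.inv_mem _ hDmem)

/-- The element `ζ ↦ ζ / (1 - u² ζ)` does not occur next to the translation by `1`. -/
theorem lowerTrans_not_mem {G : Subgroup PSL(2, ℂ)}
    (hfree : ∀ g ∈ G, ∀ p : H3, g • p = p → g = 1) (hone : toPSL (translation 1) ∈ G) :
    toPSL (lowerTrans (-u ^ 2)) ∉ G := by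
  intro hmem
  obtain ⟨p, hp⟩ := exists_fixed_point
  have h := hfree _ (by rw [map_mul]; exact G.mul_mem hone hmem) p hp
  rw [← map_one toPSL] at h
  obtain ⟨ε, -, hε⟩ := toPSL_eq_iff.mp h.symm
  have h01 := hε 0 1
  rw [sl_mul_apply] at h01
  simp [lowerTrans, sl] at h01

theorem eq_one_of_mem_conj_of_smul_eq {ΓK : Subgroup PSL(2, ℂ)}
    (hfree : ∀ g ∈ ΓK, ∀ p : H3, g • p = p → g = 1) (h : PSL(2, ℂ)) :
    ∀ g ∈ ΓK.map (MulAut.conj h).toMonoidHom, ∀ p : H3, g • p = p → g = 1 := by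
  rintro _ ⟨g, hg, rfl⟩ p hp
  have h1 : g • (h⁻¹ • p) = h⁻¹ • p := by
    rw [eq_inv_smul_iff, ← mul_smul, ← mul_smul, mul_assoc h]
    simpa [mul_assoc] using hp
  rw [hfree g hg _ h1, map_one]

/-- The three possibilities for the second meridian. -/
theorem exists_conj_meridians [ProperlyDiscontinuousSMul Γ522333 H3]
    {ΓK : Subgroup PSL(2, ℂ)} (hK : IsKnotGroup ΓK) (hle : ΓK ≤ Γ522333)
    (hidx : ΓK.relIndex Γ522333 ≠ 0) :
    ∃ h ∈ Γ522333, toPSL (translation 1) ∈ ΓK.map (MulAut.conj h).toMonoidHom ∧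
      (toPSL (lowerTrans (-u ^ 2 * ω ^ 2)) ∈ ΓK.map (MulAut.conj h).toMonoidHom ∨
        toPSL (lowerTrans (-u ^ 2 * (ω ^ 2)⁻¹)) ∈ ΓK.map (MulAut.conj h).toMonoidHom) := by
  obtain ⟨j, i, h1, h2⟩ := exists_rot_conj_meridians hK hle hidx
  refine ⟨_, Γ522333.pow_mem toPSL_rot_mem j, h1, ?_⟩
  have hmod : (ω ^ 2) ^ i = (ω ^ 2) ^ (i % 3) := pow_eq_pow_mod i ω_sq_pow_three
  rw [hmod] at h2
  have hlt : i % 3 < 3 := Nat.mod_lt _ (by norm_num)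
  interval_cases i % 3
  · refine absurd ?_ (lowerTrans_not_mem (eq_one_of_mem_conj_of_smul_eq hK.free _) h1)
    simpa using h2
  · left
    rwa [pow_one, ← neg_mul] at h2
  · right
    have h3 : (ω ^ 2)⁻¹ = (ω ^ 2) ^ 2 := by
      rw [inv_eq_iff_eq_inv, eq_comm]
      exact inv_eq_of_mul_eq_one_right (by rw [← ω_sq_pow_three]; ring)
    rwa [h3, neg_mul]

/-! ### Complex conjugation -/

theorem star_u : Complex.conjAe u = u := Complex.conj_ofReal _

theorem star_ω : Complex.conjAe ω = ω⁻¹ := by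
  rw [ω_inv]
  apply Complex.ext <;> simp [ω_re, ω_im]
  norm_num

theorem entrywise_toPSL (σ : ℂ ≃ₐ[ℝ] ℂ) (A : SL(2, ℂ)) :
    entrywise σ (toPSL A) = toPSL (entrywiseSL σ A) := rfl

theorem entrywiseSL_apply (σ : ℂ ≃ₐ[ℝ] ℂ) (A : SL(2, ℂ)) (i j : Fin 2) :
    entrywiseSL σ A i j = σ (A i j) := rfl

/-- Conjugation fixes `x`, and turns `y` and `z` into the rotation's square and cube times `y`. -/
theorem map_entrywise_le :
    Γ522333.map (entrywise Complex.conjAe).toMonoidHom ≤ Γ522333 := by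
  have hω := ω_ne_zero
  have hu := u_ne_zero
  obtain ⟨r1, r2, r3, r4⟩ := rot_pow_apply 2
  obtain ⟨q1, q2, q3, q4⟩ := rot_pow_apply 3
  rw [Subgroup.map_le_iff_le_comap, Γ522333, Subgroup.closure_le]
  rintro _ (rfl | rfl | rfl)
  · change entrywise Complex.conjAe genX ∈ Γ522333
    have : entrywise Complex.conjAe genX = genX := by
      change toPSL (entrywiseSL Complex.conjAe (sl !![u, -u⁻¹; u, 0] _)) =
        toPSL (sl !![u, -u⁻¹; u, 0] _)
      congr 1
      apply sl_ext <;> rw [entrywiseSL_apply] <;>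
        simp only [sl, Matrix.of_apply, Matrix.cons_val', Matrix.cons_val_zero,
          Matrix.cons_val_one, Matrix.cons_val_fin_one, map_neg, map_inv₀, star_u, map_zero]
    rw [this]
    exact Subgroup.subset_closure (by left; rfl)
  · change entrywise Complex.conjAe (toPSL inversion) ∈ Γ522333
    have : entrywiseSL Complex.conjAe inversion = rotation ^ 2 * inversion := by
      apply sl_ext <;> rw [entrywiseSL_apply, sl_mul_apply] <;>
        simp only [flip_apply, r1, r2, r3, r4, map_mul, map_neg, map_inv₀, star_u, star_ω,
          map_zero] <;> field_simp <;> ring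
    rw [entrywise_toPSL, this, map_mul, map_pow]
    exact Γ522333.mul_mem (Γ522333.pow_mem toPSL_rot_mem 2) toPSL_flip_mem
  · change entrywise Complex.conjAe
      (toPSL (sl !![0, ω ^ 2 * u⁻¹; -(ω ^ 2)⁻¹ * u, 0] _)) ∈ Γ522333
    have : ∀ h, entrywiseSL Complex.conjAe (sl !![0, ω ^ 2 * u⁻¹; -(ω ^ 2)⁻¹ * u, 0] h) =
        rotation ^ 3 * inversion := fun h ↦ by
      apply sl_ext <;> rw [entrywiseSL_apply, sl_mul_apply] <;>
        simp only [sl, Matrix.of_apply, Matrix.cons_val', Matrix.cons_val_zero,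
          Matrix.cons_val_one, Matrix.cons_val_fin_one, flip_apply, q1, q2, q3, q4, map_mul,
          map_neg, map_inv₀, map_pow, star_u, star_ω, map_zero] <;> field_simp <;> ring
    rw [entrywise_toPSL, this, map_mul, map_pow]
    exact Γ522333.mul_mem (Γ522333.pow_mem toPSL_rot_mem 3) toPSL_flip_mem

theorem conjIsom_mul_ofPSL (g : PSL(2, ℂ)) :
    conjIsom * ofPSL g * conjIsom⁻¹ = ofPSL (entrywise Complex.conjAe g) := by
  rw [conjIsom, ← map_inv]
  exact (SemidirectProduct.inl_aut Complex.conjAe g).symm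

theorem conjIsom_inv : conjIsom⁻¹ = conjIsom := by
  rw [conjIsom, ← map_inv]
  congr 1

-- Elements of `Γ522333` and the reflection normalize it. For the reflection one inclusion suffices,
-- because it is an involution.
open scoped Pointwise in
theorem closure_le_fullCommensurator :
    Subgroup.closure ((Γ522333.map ofPSL : Set IsomH3) ∪ {conjIsom}) ≤
      fullCommensurator Γ522333 := by
  rw [Subgroup.closure_le]
  have key : ∀ h : IsomH3, MulAut.conj h • Γ522333.map ofPSL = Γ522333.map ofPSL →
      h ∈ fullCommensurator Γ522333 := by
    intro h hh
    rw [fullCommensurator, Subgroup.Commensurable.commensurator_mem_iff]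
    have : ConjAct.toConjAct h • Γ522333.map ofPSL = Γ522333.map ofPSL := hh
    rw [this]
  rintro h (hh | rfl)
  · exact key h (Subgroup.conj_smul_eq_self_of_mem hh)
  · refine key _ ?_
    have hstep : ∀ g ∈ Γ522333, conjIsom * ofPSL g * conjIsom⁻¹ ∈ Γ522333.map ofPSL := by
      intro g hg
      rw [conjIsom_mul_ofPSL]
      exact Subgroup.mem_map_of_mem _ (map_entrywise_le (Subgroup.mem_map_of_mem _ hg))
    apply le_antisymm
    · rintro _ ⟨_, ⟨g, hg, rfl⟩, rfl⟩
      exact hstep g hg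
    · rintro _ ⟨g, hg, rfl⟩
      refine ⟨_, hstep g hg, ?_⟩
      change conjIsom * (conjIsom * ofPSL g * conjIsom⁻¹) * conjIsom⁻¹ = ofPSL g
      nth_rewrite 1 [← conjIsom_inv]
      nth_rewrite 4 [← conjIsom_inv]
      group

end DodecahedralKnots

/-! ### The proposition -/

open DodecahedralKnots
theorem proposition3p2 (ΓK : Subgroup PSL(2, ℂ)) (hK : IsKnotGroup ΓK) (hle : ΓK ≤ Γ522333)
    (hcomm : Subgroup.Commensurable ΓK Γ522333) :
    ∃ h ∈ fullCommensurator Γ522333,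
      h ∈ Subgroup.closure ((Γ522333.map ofPSL : Set IsomH3) ∪ {conjIsom}) ∧
      ∃ Γ' ≤ Γ522333,
        Γ'.map ofPSL = (ΓK.map ofPSL).map (MulAut.conj h).toMonoidHom ∧
        meridianInfty ∈ Γ' ∧ meridianZero ∈ Γ' := by
  have hPD : ProperlyDiscontinuousSMul Γ522333 H3 := by
    have := hK.discrete
    have : ΓK.IsFiniteRelIndex Γ522333 := ⟨hcomm.1⟩
    -- Proper discontinuity passes from a finite index subgroup to the whole group.
    exact ProperlyDiscontinuousSMul.ofFiniteRelIndex Γ522333 ΓK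
  obtain ⟨g, hg, hone, hzero⟩ := exists_conj_meridians hK hle hcomm.1
  have hle' : ΓK.map (MulAut.conj g).toMonoidHom ≤ Γ522333 := by
    rintro _ ⟨k, hk, rfl⟩
    exact Γ522333.mul_mem (Γ522333.mul_mem hg (hle hk)) (Γ522333.inv_mem hg)
  have hmem : ofPSL g ∈ Subgroup.closure ((Γ522333.map ofPSL : Set IsomH3) ∪ {conjIsom}) :=
    Subgroup.subset_closure (Or.inl (Subgroup.mem_map_of_mem _ hg))
  have hmap : (ΓK.map (MulAut.conj g).toMonoidHom).map ofPSL =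
      (ΓK.map ofPSL).map (MulAut.conj (ofPSL g)).toMonoidHom := by
    rw [Subgroup.map_map, Subgroup.map_map]
    congr 1
    exact MonoidHom.ext fun k ↦ by simp
  rcases hzero with hzero | hzero
  · exact ⟨ofPSL g, closure_le_fullCommensurator hmem, hmem, _, hle', hmap, hone, hzero⟩
  -- The second meridian has entry `-u²ω⁻²`; the reflection turns it into `-u²ω²` and fixes the
  -- translation by `1`.
  · have hmem' : conjIsom * ofPSL g ∈
        Subgroup.closure ((Γ522333.map ofPSL : Set IsomH3) ∪ {conjIsom}) :=
      Subgroup.mul_mem _ (Subgroup.subset_closure (Or.inr rfl)) hmem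
    refine ⟨_, closure_le_fullCommensurator hmem', hmem',
      (ΓK.map (MulAut.conj g).toMonoidHom).map (entrywise Complex.conjAe).toMonoidHom,
      (Subgroup.map_mono hle').trans map_entrywise_le, ?_, ⟨_, hone, ?_⟩, ⟨_, hzero, ?_⟩⟩
    · rw [map_mul, show (MulAut.conj conjIsom * MulAut.conj (ofPSL g)).toMonoidHom =
        (MulAut.conj conjIsom).toMonoidHom.comp (MulAut.conj (ofPSL g)).toMonoidHom from rfl,
        ← Subgroup.map_map, ← hmap, Subgroup.map_map, Subgroup.map_map _ _ ofPSL]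
      congr 1
      exact MonoidHom.ext fun k ↦ (conjIsom_mul_ofPSL k).symm
    · change toPSL (entrywiseSL Complex.conjAe (translation 1)) = toPSL (translation 1)
      congr 1
      apply sl_ext <;> rw [entrywiseSL_apply] <;> simp only [trans_apply, map_one, map_zero]
    · change toPSL (entrywiseSL Complex.conjAe (lowerTrans _)) = toPSL (lowerTrans _)
      congr 1
      apply sl_ext <;> rw [entrywiseSL_apply] <;>
        simp only [lowerTrans, sl, Matrix.of_apply, Matrix.cons_val', Matrix.cons_val_zero,
          Matrix.cons_val_one, Matrix.cons_val_fin_one, map_one, map_zero, map_mul, map_neg,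
          map_inv₀, map_pow, star_u, star_ω]
      rw [← inv_pow, inv_inv]
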